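/- Let $\Bbbk$ be an arbitrary field and $X$ a nonempty set. A Perm-algebra is an associative $\Bbbk$-algebra (not necessarily unital) satisfying $abc=bac$; an SLS-algebra is a $\Bbbk$-algebra whose product satisfies $(a,b,c)=(b,a,c)$, $((ab)c)e=((ac)b)e$ and $(a,bc,e)=(b,ac,e)$, where $(a,b,c)=(ab)c-a(bc)$. Let $X^{(\omega)}=\{x^{(n)}\mid x\in X,\ n\ge 0\}$ with $x^{(0)}=x$, and let $\mathrm{Perm}\langle X^{(\omega)}\rangle$ be the free Perm-algebra generated by $X^{(\omega)}$; its linear basis is formed by the monomials $v\,x^{(n)}$ with $x\in X$, $n\ge 0$ and $v$ a (possibly empty) commutative monomial in the letters from $X^{(\omega)}$. Equipped with the derivation $d$ such that $d(x^{(n)})=x^{(n+1)}$, it is the free differential Perm-algebra $\mathrm{PermDer}\langle X,d\rangle$ generated by $X$. Define the weight of a monomial as the sum of the weights of its letters, where $\mathrm{wt}(x^{(n)})=n-1$. Let $F$ be the subalgebra generated by $X$ in $\mathrm{PermDer}\langle X,d\rangle$ relative to the operation $f\circ g=f\,d(g)$, i.e. the least linear subspace that contains $X$ and is closed under $\circ$.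 Then a linear basis of $F$ consists of the generators $x\in X$ and all monomials $u=v\,x^{(n)}\in\mathrm{Perm}\langle X^{(\omega)}\rangle$ of weight $-1$ with $x\in X$ and $n>0$. Moreover, $(F,\circ)$ is the free SLS-algebra generated by $X$: there is an isomorphism of algebras $\mathrm{SLS}\langle X\rangle\to (F,\circ)$ with $x\mapsto x$ for all $x\in X$, so that this is also a description of a linear basis of the free SLS-algebra. -/

import Mathlib

noncomputable section

namespace SLSPaper

universe u v w

/-! ## Perm-algebras and the free differential Perm-algebra -/

/-- An associative algebra is a Perm-algebra if it satisfies the identity `abc = bac`. -/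
def IsPerm (A : Type*) [NonUnitalRing A] : Prop :=
  ∀ a b c : A, a * b * c = b * a * c

/-- A linear map is a derivation of a (not necessarily unital) algebra if it satisfies the
Leibniz rule. -/
def IsDerivation {k A : Type*} [CommRing k] [NonUnitalRing A] [Module k A]
    (d : A →ₗ[k] A) : Prop :=
  ∀ a b : A, d (a * b) = d a * b + a * d b

/-- The free Perm-algebra `Perm⟨Y⟩` over `k`: it has the linear basis of all monomials `v y`, where
`y` is a letter from `Y` and `v` is a (possibly empty) commutative monomial in the letters of `Y`.
So an element is a finite sum `∑ p_y y` with commutative polynomials `p_y`; only the last letter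
of a monomial has a distinguished place. -/
def PermFree (k : Type u) (Y : Type v) [CommRing k] : Type (max u v) :=
  Y →₀ MvPolynomial Y k

namespace PermFree

variable (k : Type u) (Y : Type v) [CommRing k]

instance instAddCommGroup : AddCommGroup (PermFree k Y) :=
  inferInstanceAs (AddCommGroup (Y →₀ MvPolynomial Y k))

instance : Module k (PermFree k Y) :=
  inferInstanceAs (Module k (Y →₀ MvPolynomial Y k))

instance : Module (MvPolynomial Y k) (PermFree k Y) :=
  inferInstanceAs (Module (MvPolynomial Y k) (Y →₀ MvPolynomial Y k))

instance : IsScalarTower k (MvPolynomial Y k) (PermFree k Y) :=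
  inferInstanceAs (IsScalarTower k (MvPolynomial Y k) (Y →₀ MvPolynomial Y k))

instance : SMulCommClass k (MvPolynomial Y k) (PermFree k Y) :=
  inferInstanceAs (SMulCommClass k (MvPolynomial Y k) (Y →₀ MvPolynomial Y k))

variable {k Y}

/-- The element `p y` for a commutative polynomial `p` and a letter `y`. -/
def term (p : MvPolynomial Y k) (y : Y) : PermFree k Y :=
  Finsupp.single y p

/-- The monomial `v y` of the free Perm-algebra, with `v` a commutative monomial given by its
exponents, and `y` the last letter. -/
def mon (v : Y →₀ ℕ) (y : Y) : PermFree k Y :=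
  term (MvPolynomial.monomial v 1) y

/-- A letter `y` as an element of the free Perm-algebra. -/
def letter (y : Y) : PermFree k Y :=
  mon 0 y

/-- The canonical map to commutative polynomials, `v y ↦ v * y`. -/
def toComm : PermFree k Y →ₗ[MvPolynomial Y k] MvPolynomial Y k :=
  Finsupp.linearCombination (MvPolynomial Y k) (MvPolynomial.X : Y → MvPolynomial Y k)

/-- Multiplication `(v y)(w z) = (v y w) z`. -/
instance instMul : Mul (PermFree k Y) where
  mul f g := toComm f • g

theorem mul_def (f g : PermFree k Y) : f * g = toComm f • g := rfl

@[simp]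
theorem toComm_term (p : MvPolynomial Y k) (y : Y) :
    toComm (term p y) = p * MvPolynomial.X y := by
  exact Finsupp.linearCombination_single (MvPolynomial Y k) p y

theorem smul_term (q p : MvPolynomial Y k) (y : Y) : q • term p y = term (q * p) y := by
  simp only [term]
  exact Finsupp.smul_single q y p

theorem smul_eq_C_smul (c : k) (f : PermFree k Y) :
    c • f = (MvPolynomial.C c : MvPolynomial Y k) • f := by
  rw [← mul_one (MvPolynomial.C c), ← MvPolynomial.smul_eq_C_mul, smul_assoc, one_smul]

instance : NonUnitalRing (PermFree k Y) :=
  { instAddCommGroup k Y, (instMul : Mul (PermFree k Y)) with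
    left_distrib := fun f g h => by simp only [mul_def, smul_add]
    right_distrib := fun f g h => by simp only [mul_def, map_add, add_smul]
    zero_mul := fun f => by simp only [mul_def, map_zero, zero_smul]
    mul_zero := fun f => by simp only [mul_def, smul_zero]
    mul_assoc := fun f g h => by
      simp only [mul_def, map_smul, smul_eq_mul, mul_smul] }

instance : IsScalarTower k (PermFree k Y) (PermFree k Y) where
  smul_assoc c f g := by
    simp only [smul_eq_mul, mul_def]
    rw [smul_eq_C_smul c f, map_smul, smul_eq_mul, mul_smul, ← smul_eq_C_smul]

instance : SMulCommClass k (PermFree k Y) (PermFree k Y) where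
  smul_comm c f g := by
    simp only [smul_eq_mul, mul_def]
    exact smul_comm c _ g

theorem isPerm : IsPerm (PermFree k Y) := fun f g h => by
  simp only [mul_def, map_smul, smul_eq_mul, mul_comm]

/-- Multiplying by a letter on the left multiplies the commutative part of a monomial. -/
theorem letter_mul_mon (y : Y) (v : Y →₀ ℕ) (z : Y) :
    (letter y * mon v z : PermFree k Y) = mon (v + Finsupp.single y 1) z := by
  rw [mul_def, letter, mon, mon, toComm_term, smul_term, mon]
  congr 1
  rw [MvPolynomial.X, MvPolynomial.monomial_mul, MvPolynomial.monomial_mul]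
  simp [add_comm]

theorem term_zero (y : Y) : term (0 : MvPolynomial Y k) y = 0 := Finsupp.single_zero y

theorem term_add (p q : MvPolynomial Y k) (y : Y) : term (p + q) y = term p y + term q y :=
  Finsupp.single_add y p q

theorem induction_mon {P : PermFree k Y → Prop} (f : PermFree k Y) (zero : P 0)
    (add : ∀ f g, P f → P g → P (f + g)) (term : ∀ p y, P (term p y)) : P f :=
  Finsupp.induction_linear (motive := P) f zero add (fun y p => term p y)

end PermFree

/-- The alphabet `X^(ω)`: the pair `(x, n)` is the letter `x^(n)`. -/
abbrev Omega (X : Type v) : Type v := X × ℕ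

/-- The free differential Perm-algebra `PermDer⟨X, d⟩`. As a Perm-algebra it is the
free Perm-algebra in the letters `x^(n)`; the derivation is `PermDer.d`. -/
abbrev PermDer (k : Type u) (X : Type v) [CommRing k] : Type (max u v) :=
  PermFree k (Omega X)

namespace PermDer

variable {k : Type u} {X : Type v} [CommRing k]

/-- The letter `x^(n+1)` for a letter `x^(n)`. -/
def next (y : Omega X) : Omega X := (y.1, y.2 + 1)

/-- The derivation of the commutative polynomial algebra on `X^(ω)` with `x^(n) ↦ x^(n+1)`. -/
def dComm : Derivation k (MvPolynomial (Omega X) k) (MvPolynomial (Omega X) k) :=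
  MvPolynomial.mkDerivation k fun y => MvPolynomial.X (next y)

/-- The derivation of the free differential Perm-algebra, `(v y)' = v' y + v y'`. -/
def d : PermDer k X →ₗ[k] PermDer k X :=
  (Finsupp.mapRange.linearMap (α := Omega X) (dComm (k := k) (X := X)).toLinearMap
    + Finsupp.lmapDomain (MvPolynomial (Omega X) k) k next :
    (Omega X →₀ MvPolynomial (Omega X) k) →ₗ[k] (Omega X →₀ MvPolynomial (Omega X) k))

theorem d_term (p : MvPolynomial (Omega X) k) (y : Omega X) :
    d (PermFree.term p y) = PermFree.term (dComm p) y + PermFree.term p (next y) := by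
  have h₁ : Finsupp.mapRange.linearMap (α := Omega X) (dComm (k := k) (X := X)).toLinearMap
      (Finsupp.single y p) = Finsupp.single y (dComm p) :=
    Finsupp.mapRange_single (hf := map_zero _)
  have h₂ : Finsupp.lmapDomain (MvPolynomial (Omega X) k) k next (Finsupp.single y p)
      = Finsupp.single (next y) p := Finsupp.mapDomain_single
  exact congrArg₂ (fun a b : Omega X →₀ MvPolynomial (Omega X) k => a + b) h₁ h₂

theorem d_letter (x : X) (n : ℕ) :
    d (PermFree.letter (x, n) : PermDer k X) = PermFree.letter (x, n + 1) := by
  rw [PermFree.letter, PermFree.mon, d_term, PermFree.letter, PermFree.mon]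
  have h : dComm (MvPolynomial.monomial (0 : Omega X →₀ ℕ) (1 : k)) = 0 := by
    have : (MvPolynomial.monomial (0 : Omega X →₀ ℕ) (1 : k)) = 1 := rfl
    rw [this]; exact Derivation.map_one_eq_zero _
  rw [h, PermFree.term_zero, zero_add, next]

theorem d_smul (p : MvPolynomial (Omega X) k) (f : PermDer k X) :
    d (p • f) = dComm p • f + p • d f := by
  induction f using PermFree.induction_mon with
  | zero => simp
  | add f g hf hg => simp only [smul_add, map_add, hf, hg]; abel
  | term q y =>
    simp only [PermFree.smul_term, d_term, smul_add, Derivation.leibniz, smul_eq_mul]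
    simp only [PermFree.term_add]
    rw [mul_comm q (dComm p)]
    abel

theorem toComm_d (f : PermDer k X) :
    PermFree.toComm (d f) = dComm (PermFree.toComm f) := by
  induction f using PermFree.induction_mon with
  | zero => simp
  | add f g hf hg => simp only [map_add, hf, hg]
  | term q y =>
    simp only [d_term, map_add, PermFree.toComm_term, Derivation.leibniz, smul_eq_mul]
    simp only [dComm, MvPolynomial.mkDerivation_X]
    ring

theorem isDerivation_d : IsDerivation (d : PermDer k X →ₗ[k] PermDer k X) := fun f g => by
  simp only [PermFree.mul_def, d_smul, toComm_d]

/-- The generator `x = x^(0)` of the free differential Perm-algebra. -/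
def gen (x : X) : PermDer k X := PermFree.letter (x, 0)


/-! ### The universal property of `PermDer⟨X, d⟩` -/

section Universal

variable {A : Type w} [NonUnitalRing A] [Module k A] [IsScalarTower k A A] [SMulCommClass k A A]

theorem exists_action (hA : IsPerm A) {Y : Type v} (a : Y → A) :
    ∃ ρ : MvPolynomial Y k →ₐ[k] Module.End k A,
      ∀ y, ρ (MvPolynomial.X y) = LinearMap.mulLeft k (a y) := by
  let s : Set (Module.End k A) := Set.range fun y => LinearMap.mulLeft k (a y)
  have hs : ∀ f ∈ s, ∀ g ∈ s, f * g = g * f := by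
    rintro _ ⟨y, rfl⟩ _ ⟨z, rfl⟩
    ext b
    simp only [Module.End.mul_apply, LinearMap.mulLeft_apply, ← mul_assoc]
    exact hA _ _ _
  have hc : IsMulCommutative (Algebra.adjoin k s) := Algebra.isMulCommutative_adjoin k hs
  let : CommRing (Algebra.adjoin k s) :=
    { (inferInstance : Ring (Algebra.adjoin k s)) with
      mul_comm := fun a b => hc.is_comm.comm a b }
  let ψ : MvPolynomial Y k →ₐ[k] Algebra.adjoin k s :=
    MvPolynomial.aeval fun y =>
      (⟨LinearMap.mulLeft k (a y), Algebra.subset_adjoin ⟨y, rfl⟩⟩ : Algebra.adjoin k s)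
  refine ⟨(Algebra.adjoin k s).val.comp ψ, fun y => ?_⟩
  have h : ψ (MvPolynomial.X y)
      = ⟨LinearMap.mulLeft k (a y), Algebra.subset_adjoin ⟨y, rfl⟩⟩ := MvPolynomial.aeval_X _ _
  rw [AlgHom.comp_apply, h]
  rfl

/-- `PermDer k X` is the free differential Perm-algebra generated by `X`: every map from `X` to a
Perm-algebra with a derivation extends uniquely to a homomorphism of differential algebras. -/
theorem existsUnique_lift (hA : IsPerm A) (δ : A →ₗ[k] A) (hδ : IsDerivation δ) (φ : X → A) :
    ∃! F : PermDer k X →ₙₐ[k] A, (∀ x, F (gen x) = φ x) ∧ ∀ f, F (d f) = δ (F f) := by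
  let a : Omega X → A := fun y => (δ^[y.2]) (φ y.1)
  have ha : ∀ y, δ (a y) = a (next y) := fun y => by
    simp only [a, next, Function.iterate_succ_apply']
  obtain ⟨ρ, hρ⟩ := exists_action (k := k) hA a
  have hρmul : ∀ (p : MvPolynomial (Omega X) k) (b c : A), ρ p b * c = ρ p (b * c) := by
    intro p
    induction p using MvPolynomial.induction_on with
    | C r =>
      intro b c
      rw [← MvPolynomial.algebraMap_eq, AlgHom.commutes]
      simp [Module.algebraMap_end_apply, smul_mul_assoc]
    | add p q hp hq => intro b c; simp [map_add, LinearMap.add_apply, add_mul, hp, hq]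
    | mul_X p y hp =>
      intro b c
      simp [map_mul, Module.End.mul_apply, hρ, hp, mul_assoc]
  have hρd : ∀ (p : MvPolynomial (Omega X) k) (b : A), δ (ρ p b) = ρ (dComm p) b + ρ p (δ b) := by
    intro p
    induction p using MvPolynomial.induction_on with
    | C r =>
      intro b
      rw [← MvPolynomial.algebraMap_eq, AlgHom.commutes, Derivation.map_algebraMap]
      simp [Module.algebraMap_end_apply]
    | add p q hp hq => intro b; simp only [map_add, LinearMap.add_apply, hp, hq]; abel
    | mul_X p y hp =>
      intro b
      have hX : dComm (MvPolynomial.X y : MvPolynomial (Omega X) k) = MvPolynomial.X (next y) :=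
        MvPolynomial.mkDerivation_X _ _ _
      simp only [map_mul, Module.End.mul_apply, hρ, hp, Derivation.leibniz, smul_eq_mul, map_add,
        LinearMap.add_apply, hX, LinearMap.mulLeft_apply, hδ (a y) b, ha]
      have hcomm : a y * ρ (dComm p) b = ρ (dComm p) (a y * b) := by
        have h := congrArg (fun q => ρ q b) (mul_comm (MvPolynomial.X y) (dComm p))
        simpa [map_mul, Module.End.mul_apply, hρ] using h
      rw [hcomm]
      abel
  let T : PermDer k X →ₗ[k] A :=
    (Finsupp.lsum k fun y => (LinearMap.applyₗ (a y)).comp ρ.toLinearMap :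
      (Omega X →₀ MvPolynomial (Omega X) k) →ₗ[k] A)
  have hT : ∀ p y, T (PermFree.term p y) = ρ p (a y) := fun p y =>
    Finsupp.lsum_single k _ y p
  have hTsmul : ∀ (p : MvPolynomial (Omega X) k) f, T (p • f) = ρ p (T f) := by
    intro p f
    induction f using PermFree.induction_mon with
    | zero => simp
    | add f g hf hg => simp only [smul_add, map_add, hf, hg]
    | term q y => simp only [PermFree.smul_term, hT, map_mul, Module.End.mul_apply]
  have hTcomm : ∀ (f : PermDer k X) (b : A), ρ (PermFree.toComm f) b = T f * b := by
    intro f b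
    induction f using PermFree.induction_mon with
    | zero => simp
    | add f g hf hg => simp only [map_add, LinearMap.add_apply, hf, hg, add_mul]
    | term q y =>
      simp only [PermFree.toComm_term, hT, map_mul, Module.End.mul_apply, hρ, hρmul,
        LinearMap.mulLeft_apply]
  have hTd : ∀ f, T (d f) = δ (T f) := by
    intro f
    induction f using PermFree.induction_mon with
    | zero => simp
    | add f g hf hg => simp only [map_add, hf, hg]
    | term q y => simp only [d_term, map_add, hT, hρd, ha]
  have hTmul : ∀ f g, T (f * g) = T f * T g := fun f g => by
    rw [PermFree.mul_def, hTsmul, hTcomm]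
  let F : PermDer k X →ₙₐ[k] A :=
    { toFun := T
      map_smul' := fun c f => map_smul T c f
      map_zero' := map_zero T
      map_add' := map_add T
      map_mul' := hTmul }
  have hFgen : ∀ x, F (gen x) = φ x := fun x => by
    change T (PermFree.term (MvPolynomial.monomial 0 1) (x, 0)) = φ x
    have h1 : (MvPolynomial.monomial (0 : Omega X →₀ ℕ) (1 : k)) = 1 := rfl
    rw [hT, h1, map_one]
    rfl
  refine ⟨F, ⟨hFgen, hTd⟩, ?_⟩
  rintro G ⟨hGgen, hGd⟩
  have hGl : ∀ y, G (PermFree.letter y) = a y := by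
    rintro ⟨x, n⟩
    induction n with
    | zero => exact hGgen x
    | succ n ih => rw [← d_letter, hGd, ih, ha]; rfl
  have hFl : ∀ y, F (PermFree.letter y) = a y := by
    rintro ⟨x, n⟩
    induction n with
    | zero => exact hFgen x
    | succ n ih =>
      rw [← d_letter]
      change T (d _) = _
      rw [hTd]
      change δ (F _) = _
      rw [ih, ha]; rfl
  refine NonUnitalAlgHom.ext fun f => ?_
  induction f using PermFree.induction_mon with
  | zero => simp
  | add f g hf hg => simp only [map_add, hf, hg]
  | term q y =>
    induction q using MvPolynomial.induction_on with
    | C r =>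
      have : (PermFree.term (MvPolynomial.C r) y : PermDer k X) = r • PermFree.letter y := by
        have h1 : (MvPolynomial.monomial (0 : Omega X →₀ ℕ) (1 : k)) = 1 := rfl
        rw [PermFree.smul_eq_C_smul, PermFree.letter, PermFree.mon, PermFree.smul_term, h1,
          mul_one]
      rw [this, map_smul, map_smul, hGl, hFl]
    | add p q hp hq => simp only [PermFree.term_add, map_add, hp, hq]
    | mul_X p z hp =>
      have : (PermFree.term (p * MvPolynomial.X z) y : PermDer k X)
          = PermFree.letter z * PermFree.term p y := by
        have h1 : (MvPolynomial.monomial (0 : Omega X →₀ ℕ) (1 : k)) = 1 := rfl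
        rw [PermFree.mul_def, PermFree.letter, PermFree.mon, PermFree.toComm_term,
          PermFree.smul_term, h1, one_mul, mul_comm]
      rw [this, map_mul, map_mul, hGl, hFl, hp]

end Universal

/-! ### The operation `∘`, the subalgebra `F`, and the weight -/

/-- The operation `f ∘ g = f d(g)`. -/
def circ (f g : PermDer k X) : PermDer k X := f * d g

variable (k X) in
/-- The subalgebra `F` generated by `X` relative to the operation `∘`: the least linear subspace
that contains `X` and is closed under `∘`. -/
def subalgF : Submodule k (PermDer k X) :=
  sInf {S : Submodule k (PermDer k X) |
    (∀ x : X, gen x ∈ S) ∧ ∀ f ∈ S, ∀ g ∈ S, circ f g ∈ S}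

/-- The weight of a letter, `wt(x^(n)) = n - 1`. -/
def wtLetter (y : Omega X) : ℤ := (y.2 : ℤ) - 1

/-- The weight of the monomial `v y`: the sum of the weights of all its letters. -/
def wt (v : Omega X →₀ ℕ) (y : Omega X) : ℤ :=
  (v.sum fun z e => (e : ℤ) * wtLetter z) + wtLetter y

variable (k X) in
/-- The set of all monomials `v x^(n)` of weight `-1` with `x ∈ X` and `n > 0`. -/
def basisMonomials : Set (PermDer k X) :=
  {u | ∃ (v : Omega X →₀ ℕ) (x : X) (n : ℕ), 0 < n ∧ wt v (x, n) = -1 ∧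
    u = PermFree.mon v (x, n)}

end PermDer

/-! ## SLS-algebras and the free SLS-algebra -/

/-- An SLS-algebra is a left-symmetric algebra, `(a,b,c) = (b,a,c)`, that satisfies
`((a b) c) e = ((a c) b) e` and `(a, b c, e) = (b, a c, e)`. -/
structure IsSLS (A : Type*) [NonUnitalNonAssocRing A] : Prop where
  left_symm : ∀ a b c : A, associator a b c = associator b a c
  right_comm : ∀ a b c e : A, ((a * b) * c) * e = ((a * c) * b) * e
  assoc_comm : ∀ a b c e : A, associator a (b * c) e = associator b (a * c) e

namespace SLS

variable (k : Type u) (X : Type v) [CommRing k]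

/-- The congruence on the free non-associative algebra generated by the identities of
SLS-algebras. -/
inductive Rel :
    FreeNonUnitalNonAssocAlgebra k X → FreeNonUnitalNonAssocAlgebra k X → Prop
  | left_symm (a b c : FreeNonUnitalNonAssocAlgebra k X) :
      Rel (associator a b c) (associator b a c)
  | right_comm (a b c e : FreeNonUnitalNonAssocAlgebra k X) :
      Rel (((a * b) * c) * e) (((a * c) * b) * e)
  | assoc_comm (a b c e : FreeNonUnitalNonAssocAlgebra k X) :
      Rel (associator a (b * c) e) (associator b (a * c) e)
  | smul (t : k) {a b : FreeNonUnitalNonAssocAlgebra k X} : Rel a b → Rel (t • a) (t • b)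
  | add_right {a b : FreeNonUnitalNonAssocAlgebra k X} (c : FreeNonUnitalNonAssocAlgebra k X) :
      Rel a b → Rel (a + c) (b + c)
  | mul_left (a : FreeNonUnitalNonAssocAlgebra k X) {b c : FreeNonUnitalNonAssocAlgebra k X} :
      Rel b c → Rel (a * b) (a * c)
  | mul_right {a b : FreeNonUnitalNonAssocAlgebra k X} (c : FreeNonUnitalNonAssocAlgebra k X) :
      Rel a b → Rel (a * c) (b * c)

variable {k X}

theorem Rel.add_left (a : FreeNonUnitalNonAssocAlgebra k X)
    {b c : FreeNonUnitalNonAssocAlgebra k X} (h : Rel k X b c) : Rel k X (a + b) (a + c) := by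
  rw [add_comm _ b, add_comm _ c]; exact h.add_right _

theorem Rel.neg {a b : FreeNonUnitalNonAssocAlgebra k X} (h : Rel k X a b) :
    Rel k X (-a) (-b) := by
  simpa only [neg_one_smul] using h.smul (-1)

theorem Rel.sub_left (a : FreeNonUnitalNonAssocAlgebra k X)
    {b c : FreeNonUnitalNonAssocAlgebra k X} (h : Rel k X b c) : Rel k X (a - b) (a - c) := by
  simpa only [sub_eq_add_neg] using h.neg.add_left a

theorem Rel.sub_right {a b : FreeNonUnitalNonAssocAlgebra k X}
    (c : FreeNonUnitalNonAssocAlgebra k X) (h : Rel k X a b) : Rel k X (a - c) (b - c) := by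
  simpa only [sub_eq_add_neg] using h.add_right (-c)

end SLS

/-- The free SLS-algebra `SLS⟨X⟩` over `k` generated by `X`: the quotient of the free
non-associative algebra by the identities of SLS-algebras. -/
def FreeSLS (k : Type u) (X : Type v) [CommRing k] : Type (max u v) :=
  Quot (SLS.Rel k X)

namespace FreeSLS

variable (k : Type u) (X : Type v) [CommRing k]

instance : SMul k (FreeSLS k X) where
  smul t := Quot.map (t • ·) fun _ _ => SLS.Rel.smul t

instance : SMul ℕ (FreeSLS k X) where
  smul n := Quot.map (n • ·) fun a b h => by
    simpa only [Nat.cast_smul_eq_nsmul] using h.smul (n : k)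

instance : SMul ℤ (FreeSLS k X) where
  smul n := Quot.map (n • ·) fun a b h => by
    simpa only [Int.cast_smul_eq_zsmul] using h.smul (n : k)

instance : Zero (FreeSLS k X) where zero := Quot.mk _ 0

instance : Add (FreeSLS k X) where
  add := Quot.map₂ (· + ·) (fun _ _ _ => SLS.Rel.add_left _) fun _ _ _ => SLS.Rel.add_right _

instance : Neg (FreeSLS k X) where
  neg := Quot.map Neg.neg fun _ _ => SLS.Rel.neg

instance : Sub (FreeSLS k X) where
  sub := Quot.map₂ Sub.sub (fun _ _ _ => SLS.Rel.sub_left _) fun _ _ _ => SLS.Rel.sub_right _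

instance : Mul (FreeSLS k X) where
  mul := Quot.map₂ (· * ·) (fun _ _ _ => SLS.Rel.mul_left _) fun _ _ _ => SLS.Rel.mul_right _

instance instRing : NonUnitalNonAssocRing (FreeSLS k X) :=
  Function.Surjective.nonUnitalNonAssocRing (Quot.mk (SLS.Rel k X)) Quot.mk_surjective rfl
    (fun _ _ => rfl) (fun _ _ => rfl) (fun _ => rfl) (fun _ _ => rfl) (fun _ _ => rfl)
    fun _ _ => rfl

instance instModule : Module k (FreeSLS k X) :=
  Function.Surjective.module k ⟨⟨Quot.mk (SLS.Rel k X), rfl⟩, fun _ _ => rfl⟩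
    Quot.mk_surjective fun _ _ => rfl

instance : IsScalarTower k (FreeSLS k X) (FreeSLS k X) where
  smul_assoc := by
    rintro t ⟨a⟩ ⟨b⟩
    exact congrArg (Quot.mk _) (smul_assoc t a b)

instance : SMulCommClass k (FreeSLS k X) (FreeSLS k X) where
  smul_comm := by
    rintro t ⟨a⟩ ⟨b⟩
    exact congrArg (Quot.mk _) (smul_comm t a b)

variable {X} in
/-- The generator of `SLS⟨X⟩` that corresponds to `x ∈ X`. -/
def of (x : X) : FreeSLS k X := Quot.mk _ (FreeNonUnitalNonAssocAlgebra.of k x)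

theorem isSLS : IsSLS (FreeSLS k X) where
  left_symm := by rintro ⟨a⟩ ⟨b⟩ ⟨c⟩; exact Quot.sound (SLS.Rel.left_symm a b c)
  right_comm := by rintro ⟨a⟩ ⟨b⟩ ⟨c⟩ ⟨e⟩; exact Quot.sound (SLS.Rel.right_comm a b c e)
  assoc_comm := by rintro ⟨a⟩ ⟨b⟩ ⟨c⟩ ⟨e⟩; exact Quot.sound (SLS.Rel.assoc_comm a b c e)

variable {k X}

/-- The universal property of the free SLS-algebra. -/
theorem existsUnique_lift {A : Type w} [NonUnitalNonAssocRing A] [Module k A]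
    [IsScalarTower k A A] [SMulCommClass k A A] (hA : IsSLS A) (φ : X → A) :
    ∃! F : FreeSLS k X →ₙₐ[k] A, ∀ x, F (of k x) = φ x := by
  let T := FreeNonUnitalNonAssocAlgebra.lift k φ
  have hassoc : ∀ a b c, T (associator a b c) = associator (T a) (T b) (T c) := fun a b c => by
    simp only [associator_apply, map_sub, map_mul]
  have hT : ∀ a b, SLS.Rel k X a b → T a = T b := by
    intro a b h
    induction h with
    | left_symm a b c => rw [hassoc, hassoc]; exact hA.left_symm _ _ _
    | right_comm a b c e => simp only [map_mul]; exact hA.right_comm _ _ _ _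
    | assoc_comm a b c e =>
      rw [hassoc, hassoc, map_mul, map_mul]; exact hA.assoc_comm _ _ _ _
    | smul t _ ih => simp only [map_smul, ih]
    | add_right c _ ih => simp only [map_add, ih]
    | mul_left a _ ih => simp only [map_mul, ih]
    | mul_right c _ ih => simp only [map_mul, ih]
  let F : FreeSLS k X →ₙₐ[k] A :=
    { toFun := fun f => Quot.liftOn f T hT
      map_smul' := by rintro t ⟨a⟩; exact map_smul T t a
      map_zero' := map_zero T
      map_add' := by rintro ⟨a⟩ ⟨b⟩; exact map_add T a b
      map_mul' := by rintro ⟨a⟩ ⟨b⟩; exact map_mul T a b }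
  refine ⟨F, fun x => FreeNonUnitalNonAssocAlgebra.lift_of_apply k φ x, fun G hG => ?_⟩
  let q : FreeNonUnitalNonAssocAlgebra k X →ₙₐ[k] FreeSLS k X :=
    { toFun := Quot.mk (SLS.Rel k X)
      map_smul' := fun _ _ => rfl
      map_zero' := rfl
      map_add' := fun _ _ => rfl
      map_mul' := fun _ _ => rfl }
  have h : G.comp q = F.comp q := by
    refine FreeNonUnitalNonAssocAlgebra.hom_ext k fun x => ?_
    exact (hG x).trans (FreeNonUnitalNonAssocAlgebra.lift_of_apply k φ x).symm
  refine NonUnitalAlgHom.ext ?_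
  rintro ⟨f⟩
  exact DFunLike.congr_fun h f

end FreeSLS

end SLSPaper

end

/-! Since `f ∘ g` is the commutative image of `f` times `g'`, the associator of `∘` is `-f g h''`,
where only the commutative images of `f` and `g` matter. The SLS identities follow, and `ofSLS` is
the induced map from the free SLS-algebra. Its range is the least subspace in the theorem. The range
lies in the span of the listed elements because `f (v x^(n))' = f v' x^(n) + f v x^(n+1)`; solving
this for the last term gives the converse, by induction on the degree and on `n`
(`exists_toComm_ofSLS_eq`, `exists_ofSLS_eq_term`). Linear independence is that of the monomials of
the free Perm-algebra.

The hard point is injectivity. It rests on the fact that left multiplication by `s` in the free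
SLS-algebra depends only on the commutative image of `s`. This is proved degree by degree. Let a
linear map `l` recover left multiplications from commutative images up to degree `m` (`IsRep`). The
formula above forces the inverse to be `v x^(n+1) ↦ T_n(v) x` with `T_0 = l` and `T_{n+1}(f v) =
l(f) T_n(v) - T_n(f v')` for `f` of weight `-1`. These operators (`brace`) are well defined by left
symmetry and `(a,bc,e) = (b,ac,e)` (`IsBraceable.brace_symm`), and they invert `ofSLS` up to degree
`m + 1` (`IsRep.toSLS_ofSLS`). To extend `l` to degree `m + 1`, two monomials differing in the
choice of last letter must act equally from the left. This is where `((ab)c)e = ((ac)b)e` enters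
(`IsRep.brace_swap`). -/

namespace SLSPaper

universe u v

open MvPolynomial (monomial)

namespace PermDer

variable {k : Type u} {X : Type v} [CommRing k]

/-! ### Weights and degrees of commutative monomials -/

/-- The weight of a commutative monomial, given by its exponents. -/
noncomputable def expWt : (Omega X →₀ ℕ) →+ ℤ :=
  Finsupp.liftAddHom fun y => (AddMonoidHom.mulRight (wtLetter y)).comp (Nat.castAddMonoidHom ℤ)

theorem expWt_apply (v : Omega X →₀ ℕ) : expWt v = v.sum fun z e => (e : ℤ) * wtLetter z := rfl

theorem wt_eq (v : Omega X →₀ ℕ) (y : Omega X) : wt v y = expWt v + wtLetter y := rfl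

@[simp]
theorem expWt_single (y : Omega X) : expWt (Finsupp.single y 1) = wtLetter y := by
  simp [expWt_apply]

theorem exists_eq_single_add {v : Omega X →₀ ℕ} {y : Omega X} (h : v y ≠ 0) :
    ∃ u, v = Finsupp.single y 1 + u :=
  ⟨v - Finsupp.single y 1, (add_tsub_cancel_of_le
    (Finsupp.single_le_iff.2 (Nat.one_le_iff_ne_zero.2 h))).symm⟩

/-- Only letters of order zero have negative weight. -/
theorem exists_split_zero {v : Omega X →₀ ℕ} (h : expWt v < 0) :
    ∃ (x : X) (u : Omega X →₀ ℕ), v = Finsupp.single (x, 0) 1 + u := by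
  by_contra! hc
  refine absurd h (not_lt.2 ?_)
  rw [expWt_apply]
  refine Finset.sum_nonneg fun y hy => mul_nonneg (by positivity) ?_
  obtain ⟨x, n⟩ := y
  rcases n with _ | n
  · obtain ⟨u, hu⟩ := exists_eq_single_add (Finsupp.mem_support_iff.1 hy)
    exact absurd hu (hc x u)
  · simp [wtLetter]

theorem exists_split_pos {v : Omega X →₀ ℕ} (h : 0 ≤ expWt v) (hv : v ≠ 0) :
    ∃ (x : X) (n : ℕ) (u : Omega X →₀ ℕ), v = Finsupp.single (x, n + 1) 1 + u := by
  by_contra! hc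
  refine absurd h (not_le.2 ?_)
  rw [expWt_apply]
  refine Finset.sum_neg (fun y hy => ?_) (Finsupp.support_nonempty_iff.2 hv)
  obtain ⟨x, n⟩ := y
  have hy' := Finsupp.mem_support_iff.1 hy
  rcases n with _ | n
  · simp only [wtLetter]
    have : 0 < v (x, 0) := Nat.pos_of_ne_zero hy'
    push_cast; omega
  · obtain ⟨u, hu⟩ := exists_eq_single_add hy'
    exact absurd hu (hc x n u)

variable (k) in
/-- The span of the commutative monomials of weight `w` and of degree at most `m`. -/
noncomputable def wtPart (w : ℤ) (m : ℕ) : Submodule k (MvPolynomial (Omega X) k) :=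
  Submodule.span k
    {p | ∃ v : Omega X →₀ ℕ, expWt v = w ∧ v.degree ≤ m ∧ p = monomial v 1}

theorem monomial_mem_wtPart {v : Omega X →₀ ℕ} {w : ℤ} {m : ℕ} (hw : expWt v = w)
    (hm : v.degree ≤ m) : monomial v (1 : k) ∈ wtPart k w m :=
  Submodule.subset_span ⟨v, hw, hm, rfl⟩

theorem wtPart_le {w : ℤ} {m : ℕ} {N : Submodule k (MvPolynomial (Omega X) k)}
    (h : ∀ v : Omega X →₀ ℕ, expWt v = w → v.degree ≤ m → monomial v (1 : k) ∈ N) :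
    wtPart k w m ≤ N := by
  refine Submodule.span_le.2 ?_
  rintro _ ⟨v, h1, h2, rfl⟩
  exact h v h1 h2

theorem wtPart_mono {w : ℤ} {m n : ℕ} (h : m ≤ n) :
    wtPart k w m ≤ wtPart (X := X) k w n :=
  wtPart_le fun _ h1 h2 => monomial_mem_wtPart h1 (h2.trans h)

theorem X_mem_wtPart (y : Omega X) :
    (MvPolynomial.X y : MvPolynomial (Omega X) k) ∈ wtPart k (wtLetter y) 1 :=
  monomial_mem_wtPart (expWt_single y) (by simp)

theorem X_zero_mem_wtPart (x : X) :
    (MvPolynomial.X (x, 0) : MvPolynomial (Omega X) k) ∈ wtPart k (-1) 1 := by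
  simpa [wtLetter] using X_mem_wtPart (k := k) (x, 0)

theorem X_succ_mem_wtPart (x : X) (n : ℕ) :
    (MvPolynomial.X (x, n + 1) : MvPolynomial (Omega X) k) ∈ wtPart k n 1 := by
  simpa [wtLetter] using X_mem_wtPart (k := k) (x, n + 1)

theorem mul_mem_wtPart {a b c : ℤ} {i j l : ℕ} {p q : MvPolynomial (Omega X) k}
    (hp : p ∈ wtPart k a i) (hq : q ∈ wtPart k b j) (hc : a + b = c) (hl : i + j ≤ l) :
    p * q ∈ wtPart k c l := by
  have h := Submodule.mul_mem_mul hp hq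
  rw [wtPart, wtPart, Submodule.span_mul_span] at h
  refine (Submodule.span_le.2 ?_) h
  rintro _ ⟨_, ⟨v, hv, hv', rfl⟩, _, ⟨w, hw, hw', rfl⟩, rfl⟩
  simp only [MvPolynomial.monomial_mul, mul_one]
  exact monomial_mem_wtPart (by rw [map_add, hv, hw, hc]) (by rw [map_add]; omega)

theorem monomial_single_add (y : Omega X) (u : Omega X →₀ ℕ) :
    (monomial (Finsupp.single y 1 + u) 1 : MvPolynomial (Omega X) k)
      = MvPolynomial.X y * monomial u 1 := by
  rw [MvPolynomial.X, MvPolynomial.monomial_mul, one_mul]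

@[simp]
theorem dComm_X (y : Omega X) :
    dComm (MvPolynomial.X y : MvPolynomial (Omega X) k) = MvPolynomial.X (next y) :=
  MvPolynomial.mkDerivation_X _ _ _

theorem dComm_mul (p q : MvPolynomial (Omega X) k) :
    dComm (p * q) = dComm p * q + p * dComm q := by
  rw [Derivation.leibniz, smul_eq_mul, smul_eq_mul]; ring

/-- Each term of the derivative replaces one letter `y` by `next y`, which raises the weight by one
and keeps the degree. -/
theorem dComm_mem_wtPart {w w' : ℤ} {m : ℕ} {p : MvPolynomial (Omega X) k}
    (hp : p ∈ wtPart k w m) (hw : w + 1 = w') : dComm p ∈ wtPart k w' m := by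
  suffices h : wtPart k w m ≤ (wtPart k w' m).comap (dComm (k := k) (X := X)).toLinearMap from h hp
  refine wtPart_le fun v hv hm => ?_
  change (dComm (monomial v (1 : k)) : MvPolynomial (Omega X) k) ∈ wtPart k w' m
  rw [dComm, MvPolynomial.mkDerivation_monomial, one_smul]
  refine Submodule.sum_mem _ fun y hy => ?_
  obtain ⟨u, rfl⟩ := exists_eq_single_add (Finsupp.mem_support_iff.1 hy)
  have hs : Finsupp.single y 1 + u - Finsupp.single y 1 = u := by simp
  have hc : (monomial u (((Finsupp.single y 1 + u : Omega X →₀ ℕ) y : ℕ) : k) :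
      MvPolynomial (Omega X) k)
      = (((Finsupp.single y 1 + u : Omega X →₀ ℕ) y : ℕ) : k) • monomial u 1 := by
    rw [MvPolynomial.smul_monomial, smul_eq_mul, mul_one]
  simp only [hs, smul_eq_mul]
  rw [hc, smul_mul_assoc]
  rw [map_add, expWt_single] at hv
  simp only [map_add, Finsupp.degree_single] at hm
  refine Submodule.smul_mem _ _
    (mul_mem_wtPart (monomial_mem_wtPart rfl le_rfl) (X_mem_wtPart _) ?_ (by omega))
  rw [← hw, ← hv]
  simp only [wtLetter, next]
  push_cast; ring

/-- The weight zero part is generated, as an algebra, by the derivatives of the elements of weight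
`-1`. -/
theorem wtPart_zero_le (A : ℕ → Submodule k (MvPolynomial (Omega X) k)) (hA : Monotone A)
    (one : 1 ∈ A 0) (der : ∀ j, ∀ c ∈ wtPart k (-1) j, dComm c ∈ A j)
    (mul : ∀ i j, ∀ p ∈ A i, ∀ q ∈ A j, p * q ∈ A (i + j)) (m : ℕ) : wtPart k 0 m ≤ A m := by
  induction m using Nat.strong_induction_on with
  | _ m ih =>
  -- The order of the letter is lowered by `x^(n+2) p = (x^(n+1) p)' - x^(n+1) p'`, where `x^(n+1)
  -- p` has weight `-1`. At the bottom `x^(1) = x'`, and `p` is a weight-zero factor of smaller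
  -- degree.
  have key : ∀ n l : ℕ, l + 1 ≤ m → ∀ x : X, ∀ p ∈ wtPart k (-(n : ℤ)) l,
      MvPolynomial.X (x, n + 1) * p ∈ A m := by
    intro n
    induction n with
    | zero =>
      intro l hl x p hp
      have h1 : (MvPolynomial.X (x, 0 + 1) : MvPolynomial (Omega X) k) ∈ A 1 := by
        have := der 1 _ (X_zero_mem_wtPart x)
        rwa [dComm_X] at this
      refine hA (show 1 + l ≤ m by omega) (mul 1 l _ h1 _ (ih l (by omega) ?_))
      simpa using hp
    | succ n ihn =>
      intro l hl x p hp
      have h1 := der m (MvPolynomial.X (x, n + 1) * p)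
        (mul_mem_wtPart (X_succ_mem_wtPart x n) hp (by push_cast; ring) (by omega))
      have h2 := ihn l hl x _ (dComm_mem_wtPart hp (w' := -(n : ℤ)) (by push_cast; ring))
      rw [dComm_mul, dComm_X] at h1
      simpa [next] using Submodule.sub_mem _ h1 h2
  refine wtPart_le fun v hv hm => ?_
  by_cases h0 : v = 0
  · subst h0; exact hA (Nat.zero_le m) one
  obtain ⟨x, n, u, rfl⟩ := exists_split_pos hv.ge h0
  rw [map_add, expWt_single] at hv
  simp only [map_add, Finsupp.degree_single] at hm
  rw [monomial_single_add]
  refine key n u.degree (by omega) x _ (monomial_mem_wtPart ?_ le_rfl)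
  simp only [wtLetter] at hv; push_cast at hv; linarith

/-! ### Brace operators -/

section Brace

variable {R : Type*} [Ring R] [Algebra k R]

/-- The expression `l(f) T(v) - T(f v')`, bilinear in `f` and `v`. -/
noncomputable def braceStep (l T : MvPolynomial (Omega X) k →ₗ[k] R) :
    MvPolynomial (Omega X) k →ₗ[k] MvPolynomial (Omega X) k →ₗ[k] R :=
  LinearMap.mk₂ k (fun f v => l f * T v - T (f * dComm v))
    (fun f g v => by simp only [map_add, add_mul]; abel)
    (fun c f v => by simp only [map_smul, smul_mul_assoc, smul_sub])
    (fun f v w => by simp only [map_add, mul_add]; abel)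
    (fun c f v => by simp only [map_smul, Derivation.map_smul, mul_smul_comm, smul_sub])

theorem braceStep_apply (l T : MvPolynomial (Omega X) k →ₗ[k] R) (f v : MvPolynomial (Omega X) k) :
    braceStep l T f v = l f * T v - T (f * dComm v) := rfl

open Classical in
/-- The operators `T n`, defined by `T 0 = l` and the recursion
`T (n + 1) (f v) = l f * T n v - T n (f v')`, where a letter `f` of order zero is split off. -/
noncomputable def brace (l : MvPolynomial (Omega X) k →ₗ[k] R) :
    ℕ → MvPolynomial (Omega X) k →ₗ[k] R
  | 0 => l
  -- The letter split off is an arbitrary choice; independence of it in weight `-(n + 2)` comes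
  -- later, in `brace_succ_of_symm`. Monomials of negative weight always contain such a letter, so
  -- the value `0` is a mere default.
  | n + 1 => (MvPolynomial.basisMonomials (Omega X) k).constr k fun m =>
      if h : ∃ p : X × (Omega X →₀ ℕ), m = Finsupp.single (p.1, 0) 1 + p.2 then
        braceStep l (brace l n) (MvPolynomial.X (h.choose.1, 0)) (monomial h.choose.2 1)
      else 0

theorem brace_zero (l : MvPolynomial (Omega X) k →ₗ[k] R) : brace l 0 = l := rfl

theorem exists_brace_succ_monomial (l : MvPolynomial (Omega X) k →ₗ[k] R) (n : ℕ)
    {m : Omega X →₀ ℕ} (hm : expWt m < 0) :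
    ∃ (z : X) (w : Omega X →₀ ℕ), m = Finsupp.single (z, 0) 1 + w ∧
      brace l (n + 1) (monomial m 1)
        = braceStep l (brace l n) (MvPolynomial.X (z, 0)) (monomial w 1) := by
  classical
  have h : ∃ p : X × (Omega X →₀ ℕ), m = Finsupp.single (p.1, 0) 1 + p.2 := by
    obtain ⟨x, u, hu⟩ := exists_split_zero hm
    exact ⟨(x, u), hu⟩
  refine ⟨h.choose.1, h.choose.2, h.choose_spec, ?_⟩
  have hb : (monomial m 1 : MvPolynomial (Omega X) k) = MvPolynomial.basisMonomials _ k m :=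
    (congrFun (MvPolynomial.coe_basisMonomials _ _) m).symm
  rw [brace, hb, Module.Basis.constr_basis, dif_pos h]

/-- The identities that a linear map `l` from the elements of weight `-1` has to satisfy, up to
degree `m`, for the brace operators to be well-defined. -/
structure IsBraceable (l : MvPolynomial (Omega X) k →ₗ[k] R) (m : ℕ) : Prop where
  symm : ∀ i j, i + j ≤ m → ∀ f ∈ wtPart k (-1) i, ∀ g ∈ wtPart k (-1) j,
    braceStep l l f g = braceStep l l g f
  exch : ∀ i j e, i + j + e ≤ m → ∀ f ∈ wtPart k (-1) i, ∀ g ∈ wtPart k (-1) j,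
    ∀ c ∈ wtPart k (-1) e, braceStep l l f (g * dComm c) = braceStep l l g (f * dComm c)

/-- The field `exch` covers the case that `u` is a derivative, and derivatives generate the
weight-zero part. For a product `u = p q`, first `q` is exchanged between `f` and `g p`, then `symm`
swaps `g p` with `f q`, then `p` is exchanged. -/
theorem IsBraceable.exch_zero {l : MvPolynomial (Omega X) k →ₗ[k] R} {m : ℕ}
    (hl : IsBraceable l m) {i j e : ℕ} (h : i + j + e ≤ m) {f g u : MvPolynomial (Omega X) k}
    (hf : f ∈ wtPart k (-1) i) (hg : g ∈ wtPart k (-1) j) (hu : u ∈ wtPart k 0 e) :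
    braceStep l l f (g * u) = braceStep l l g (f * u) := by
  let A : ℕ → Submodule k (MvPolynomial (Omega X) k) := fun e =>
    { carrier := {u | u ∈ wtPart k 0 e ∧ ∀ i j, i + j + e ≤ m → ∀ f ∈ wtPart k (-1) i,
        ∀ g ∈ wtPart k (-1) j, braceStep l l f (g * u) = braceStep l l g (f * u)}
      add_mem' := fun {a b} ha hb => ⟨Submodule.add_mem _ ha.1 hb.1, fun i j h f hf g hg => by
        rw [mul_add, mul_add, map_add, map_add, ha.2 i j h f hf g hg, hb.2 i j h f hf g hg]⟩
      zero_mem' := ⟨Submodule.zero_mem _, fun i j h f hf g hg => by simp⟩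
      smul_mem' := fun c a ha => ⟨Submodule.smul_mem _ c ha.1, fun i j h f hf g hg => by
        rw [mul_smul_comm, mul_smul_comm, map_smul, map_smul, ha.2 i j h f hf g hg]⟩ }
  refine (wtPart_zero_le A ?_ ?_ ?_ ?_ e hu).2 i j h f hf g hg
  · exact fun a b hab u hu => ⟨wtPart_mono hab hu.1, fun i j h => hu.2 i j (by omega)⟩
  · refine ⟨monomial_mem_wtPart (v := 0) (map_zero _) (by simp), fun i j h f hf g hg => ?_⟩
    rw [mul_one, mul_one]
    exact hl.symm i j (by omega) f hf g hg
  · exact fun e c hc => ⟨dComm_mem_wtPart hc (by norm_num), fun i j h f hf g hg =>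
      hl.exch i j e h f hf g hg c hc⟩
  · refine fun a b p hp q hq => ⟨mul_mem_wtPart hp.1 hq.1 (by norm_num) le_rfl,
      fun i j h f hf g hg => ?_⟩
    have hgp := mul_mem_wtPart hg hp.1 (c := -1) (by norm_num) le_rfl
    have hfq := mul_mem_wtPart hf hq.1 (c := -1) (by norm_num) le_rfl
    rw [← mul_assoc, hq.2 i (j + a) (by omega) f hf _ hgp,
      hl.symm (j + a) (i + b) (by omega) _ hgp _ hfq,
      hp.2 (i + b) j (by omega) _ hfq g hg]
    congr 1; ring

/-- Upgrades the recursion from the chosen letter to any factor `f` of weight `-1`. The exchange law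
`hs` at level `n` carries the chosen letter `z` over to `f`. -/
theorem brace_succ_of_symm {l : MvPolynomial (Omega X) k →ₗ[k] R} {m n : ℕ}
    (hs : ∀ i j e, i + j + e ≤ m → ∀ f ∈ wtPart k (-1) i, ∀ g ∈ wtPart k (-1) j,
      ∀ w ∈ wtPart k (-(n : ℤ)) e,
      braceStep l (brace l n) f (g * w) = braceStep l (brace l n) g (f * w))
    {i j : ℕ} (h : i + j ≤ m) {f v : MvPolynomial (Omega X) k}
    (hf : f ∈ wtPart k (-1) i) (hv : v ∈ wtPart k (-(n + 1 : ℤ)) j) :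
    brace l (n + 1) (f * v) = braceStep l (brace l n) f v := by
  have key : ∀ a : Omega X →₀ ℕ, expWt a = -1 → a.degree ≤ i →
      ∀ b : Omega X →₀ ℕ, expWt b = -(n + 1 : ℤ) → b.degree ≤ j →
      brace l (n + 1) (monomial a 1 * monomial b 1)
        = braceStep l (brace l n) (monomial a 1) (monomial b 1) := by
    intro a ha hai b hb hbj
    obtain ⟨z, w, hzw, hB⟩ := exists_brace_succ_monomial l n (m := a + b)
      (by rw [map_add, ha, hb]; linarith)
    rw [MvPolynomial.monomial_mul, one_mul, hB]
    have hz : a (z, 0) ≠ 0 ∨ b (z, 0) ≠ 0 := by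
      by_contra! hc
      have := DFunLike.congr_fun hzw (z, 0)
      simp [hc.1, hc.2] at this
      omega
    rcases hz with hz | hz
    -- If `z` lies in the first factor, a letter `x` of order zero in the second one serves as an
    -- intermediary: `z` is exchanged with `x`, and then `x` with the whole first factor.
    · obtain ⟨a', rfl⟩ := exists_eq_single_add hz
      obtain ⟨x, b', rfl⟩ := exists_split_zero (v := b) (by rw [hb]; linarith)
      have hw : w = Finsupp.single (x, 0) 1 + (a' + b') := by
        rw [add_assoc] at hzw
        rw [← add_left_cancel hzw]; abel
      simp only [map_add, expWt_single, wtLetter, Finsupp.degree_single] at ha hb hai hbj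
      push_cast at ha hb
      have hab : (monomial (a' + b') 1 : MvPolynomial (Omega X) k)
          ∈ wtPart k (-(n : ℤ)) (a' + b').degree :=
        monomial_mem_wtPart (by rw [map_add]; linarith) le_rfl
      have hza : (monomial (Finsupp.single (z, 0) 1 + a') 1 : MvPolynomial (Omega X) k)
          ∈ wtPart k (-1) (1 + a'.degree) :=
        monomial_mem_wtPart (by simp [wtLetter]; linarith) (by simp)
      rw [hw, monomial_single_add (x, 0), monomial_single_add (x, 0) b',
        hs 1 1 _ (by rw [map_add]; omega) _ (X_zero_mem_wtPart z) _ (X_zero_mem_wtPart x) _ hab,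
        ← monomial_single_add, ← add_assoc,
        hs (1 + a'.degree) 1 b'.degree (by omega) _ hza _ (X_zero_mem_wtPart x) _
          (monomial_mem_wtPart (by linarith) le_rfl),
        MvPolynomial.monomial_mul, one_mul]
    · obtain ⟨b', rfl⟩ := exists_eq_single_add hz
      have hw : w = a + b' := by
        rw [add_left_comm] at hzw
        exact (add_left_cancel hzw).symm
      simp only [map_add, expWt_single, wtLetter, Finsupp.degree_single] at hb hbj
      push_cast at hb
      have hm : (monomial (a + b') 1 : MvPolynomial (Omega X) k)
          = monomial a 1 * monomial b' 1 := by rw [MvPolynomial.monomial_mul, one_mul]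
      rw [hw, hm, monomial_single_add]
      exact hs 1 i b'.degree (by omega) _ (X_zero_mem_wtPart z) _ (monomial_mem_wtPart ha hai) _
        (monomial_mem_wtPart (by linarith) le_rfl)
  have h1 : ∀ b : Omega X →₀ ℕ, expWt b = -(n + 1 : ℤ) → b.degree ≤ j →
      wtPart k (-1) i ≤ LinearMap.eqLocus
        ((brace l (n + 1)).comp (LinearMap.mulRight k (monomial b (1 : k))))
        ((braceStep l (brace l n)).flip (monomial b 1)) := fun b hb hbj =>
    wtPart_le fun a ha hai => key a ha hai b hb hbj
  have h2 : wtPart k (-(n + 1 : ℤ)) j ≤ LinearMap.eqLocus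
        ((brace l (n + 1)).comp (LinearMap.mulLeft k f)) (braceStep l (brace l n) f) :=
    wtPart_le fun b hb hbj => h1 b hb hbj hf
  exact h2 hv

/-- In the induction step the expression expands into `braceStep l l f g * brace l n w` and terms
that involve `f` and `g` only through `f * g`. So the exchange law reduces to the symmetry of
`braceStep l l`. -/
theorem IsBraceable.brace_symm {l : MvPolynomial (Omega X) k →ₗ[k] R} {m : ℕ}
    (hl : IsBraceable l m) (n : ℕ) : ∀ i j e, i + j + e ≤ m → ∀ f ∈ wtPart k (-1) i,
      ∀ g ∈ wtPart k (-1) j, ∀ w ∈ wtPart k (-(n : ℤ)) e,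
      braceStep l (brace l n) f (g * w) = braceStep l (brace l n) g (f * w) := by
  induction n with
  | zero =>
    intro i j e h f hf g hg w hw
    exact hl.exch_zero h hf hg (by simpa using hw)
  | succ n ih =>
    have expand : ∀ i j e, i + j + e ≤ m → ∀ f ∈ wtPart k (-1) i,
        ∀ g ∈ wtPart k (-1) j, ∀ w ∈ wtPart k (-((n + 1 : ℕ) : ℤ)) e,
        braceStep l (brace l (n + 1)) f (g * w) = braceStep l l f g * brace l n w
          - brace l (n + 1) (f * g * dComm w) - brace l (n + 1) (f * g * dComm w)
          - brace l n (f * g * dComm (dComm w)) := by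
      intro i j e h f hf g hg w hw
      rw [Nat.cast_succ] at hw
      have hw' := dComm_mem_wtPart hw (w' := -(n : ℤ)) (by ring)
      have hg' := dComm_mem_wtPart hg (w' := 0) (by norm_num)
      have e1 := brace_succ_of_symm ih (show j + e ≤ m by omega) hg hw
      have e2 := brace_succ_of_symm ih (show i + (j + e) ≤ m by omega) hf
        (mul_mem_wtPart hg hw' (c := -(n + 1 : ℤ)) (by ring) le_rfl)
      -- Here `f g'` is split off as a single factor, since it has weight `-1`.
      have e3 := brace_succ_of_symm ih h (mul_mem_wtPart hf hg' (by norm_num) le_rfl) hw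
      simp only [braceStep_apply] at e1 e2 e3 ⊢
      rw [dComm_mul] at e2 ⊢
      rw [e1, mul_add, map_add, ← mul_assoc f (dComm g), e3, ← mul_assoc f g]
      rw [mul_add, map_add, ← mul_assoc, ← mul_assoc, ← mul_assoc] at e2
      rw [mul_sub, ← mul_assoc (l f), sub_mul]
      have e4 : l f * brace l n (g * dComm w) = brace l (n + 1) (f * g * dComm w)
          + brace l n (f * dComm g * dComm w) + brace l n (f * g * dComm (dComm w)) := by
        rw [e2]; abel
      rw [e4]; abel
    intro i j e h f hf g hg w hw
    rw [expand i j e h f hf g hg w hw, expand j i e (by omega) g hg f hf w hw,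
      hl.symm i j (by omega) f hf g hg, mul_comm f g]

theorem IsBraceable.brace_succ {l : MvPolynomial (Omega X) k →ₗ[k] R} {m : ℕ}
    (hl : IsBraceable l m) (n : ℕ) {i j : ℕ} (h : i + j ≤ m) {f v : MvPolynomial (Omega X) k}
    (hf : f ∈ wtPart k (-1) i) (hv : v ∈ wtPart k (-(n + 1 : ℤ)) j) :
    brace l (n + 1) (f * v) = l f * brace l n v - brace l n (f * dComm v) :=
  brace_succ_of_symm (hl.brace_symm n) h hf hv

end Brace

end PermDer

/-! ### The homomorphism from the free SLS-algebra -/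

namespace PermDer

variable (k : Type u) (X : Type v) [CommRing k]

variable {k X} in
theorem circ_eq (f g : PermDer k X) :
    circ f g = PermFree.toComm f • d g := rfl

variable {k X} in
theorem toComm_circ (f g : PermDer k X) :
    PermFree.toComm (circ f g) = PermFree.toComm f * dComm (PermFree.toComm g) := by
  rw [circ_eq, map_smul, smul_eq_mul, toComm_d]

variable {k X} in
theorem d_circ (f g : PermDer k X) :
    d (circ f g) = dComm (PermFree.toComm f) • d g + PermFree.toComm f • d (d g) := by
  rw [circ_eq, d_smul]

/-- The space `PermDer k X` with the operation `∘` as its multiplication. -/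
def CircAlgebra : Type (max u v) := PermDer k X

namespace CircAlgebra

noncomputable instance : AddCommGroup (CircAlgebra k X) :=
  inferInstanceAs (AddCommGroup (PermDer k X))

noncomputable instance : Module k (CircAlgebra k X) :=
  inferInstanceAs (Module k (PermDer k X))

/-- The identity map from `CircAlgebra k X` to `PermDer k X`. -/
noncomputable def val : CircAlgebra k X ≃ₗ[k] PermDer k X := LinearEquiv.refl k (PermDer k X)

noncomputable instance : Mul (CircAlgebra k X) where
  mul f g := (val k X).symm (circ (val k X f) (val k X g))

variable {k X}

theorem val_mul (f g : CircAlgebra k X) : val k X (f * g) = circ (val k X f) (val k X g) :=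
  (val k X).apply_symm_apply _

noncomputable instance : NonUnitalNonAssocRing (CircAlgebra k X) where
  left_distrib f g h := (val k X).injective <| by
    simp only [val_mul, map_add, circ_eq, smul_add]
  right_distrib f g h := (val k X).injective <| by
    simp only [val_mul, map_add, circ_eq, add_smul]
  zero_mul f := (val k X).injective <| by simp only [val_mul, map_zero, circ_eq, zero_smul]
  mul_zero f := (val k X).injective <| by simp only [val_mul, map_zero, circ_eq, smul_zero]

instance : IsScalarTower k (CircAlgebra k X) (CircAlgebra k X) where
  smul_assoc c f g := (val k X).injective <| by
    simp only [smul_eq_mul, val_mul, map_smul, circ, smul_mul_assoc]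

instance : SMulCommClass k (CircAlgebra k X) (CircAlgebra k X) where
  smul_comm c f g := (val k X).injective <| by
    simp only [smul_eq_mul, val_mul, map_smul, circ, mul_smul_comm]

/-- The terms `f g' h'` cancel. What remains depends on `f` and `g` only through the product of
their commutative images, which yields both associator identities. -/
theorem val_associator (f g h : CircAlgebra k X) : val k X (associator f g h)
    = -((PermFree.toComm (val k X f) * PermFree.toComm (val k X g)) • d (d (val k X h))) := by
  rw [associator_apply, map_sub]
  simp only [val_mul]
  rw [circ_eq (circ _ _), toComm_circ, circ_eq, d_circ, smul_add, smul_smul, smul_smul]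
  abel

theorem isSLS : IsSLS (CircAlgebra k X) where
  left_symm a b c := (val k X).injective <| by rw [val_associator, val_associator, mul_comm]
  right_comm a b c e := (val k X).injective <| by
    simp only [val_mul]
    rw [circ_eq (circ (circ _ _) _), circ_eq (circ (circ _ _) _)]
    simp only [toComm_circ]
    rw [mul_right_comm]
  assoc_comm a b c e := (val k X).injective <| by
    rw [val_associator, val_associator, val_mul, val_mul, toComm_circ, toComm_circ, mul_left_comm]

end CircAlgebra

theorem exists_ofSLS : ∃ τ : FreeSLS k X →ₗ[k] PermDer k X,
    (∀ x, τ (FreeSLS.of k x) = gen x) ∧ ∀ f g, τ (f * g) = circ (τ f) (τ g) := by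
  obtain ⟨F, hF, -⟩ := FreeSLS.existsUnique_lift (k := k) (X := X) CircAlgebra.isSLS
    fun x => (CircAlgebra.val k X).symm (gen x)
  refine ⟨(CircAlgebra.val k X).toLinearMap.comp (F : FreeSLS k X →ₗ[k] CircAlgebra k X),
    fun x => ?_, fun f g => ?_⟩
  · change CircAlgebra.val k X (F _) = _
    rw [hF, LinearEquiv.apply_symm_apply]
  · change CircAlgebra.val k X (F _) = circ (CircAlgebra.val k X (F _)) (CircAlgebra.val k X (F _))
    rw [map_mul, CircAlgebra.val_mul]

variable {k X}

variable (k X) in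
/-- The map `toComm` as a linear map over `k`. -/
noncomputable def toCommHom : PermDer k X →ₗ[k] MvPolynomial (Omega X) k :=
  (PermFree.toComm (k := k) (Y := Omega X)).restrictScalars k

/-- The linear map `SLS⟨X⟩ → PermDer⟨X, d⟩` that sends products to `∘`. -/
noncomputable def ofSLS : FreeSLS k X →ₗ[k] PermDer k X := (exists_ofSLS k X).choose

theorem ofSLS_of (x : X) : ofSLS (FreeSLS.of k x) = gen x := (exists_ofSLS k X).choose_spec.1 x

theorem ofSLS_mul (f g : FreeSLS k X) :
    ofSLS (f * g) = PermFree.toComm (ofSLS f) • d (ofSLS g) :=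
  (exists_ofSLS k X).choose_spec.2 f g

theorem toComm_ofSLS_mul (f g : FreeSLS k X) : PermFree.toComm (ofSLS (f * g))
    = PermFree.toComm (ofSLS f) * dComm (PermFree.toComm (ofSLS g)) := by
  rw [ofSLS_mul, map_smul, smul_eq_mul, toComm_d]

theorem gen_eq (x : X) : (gen x : PermDer k X) = PermFree.term 1 (x, 0) := rfl

theorem d_gen (x : X) : d (gen x : PermDer k X) = PermFree.term 1 (x, 1) := d_letter x 0

theorem toComm_gen (x : X) : PermFree.toComm (gen x : PermDer k X) = MvPolynomial.X (x, 0) := by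
  rw [gen_eq, PermFree.toComm_term, one_mul]

end PermDer

/-! ### The filtration of the free SLS-algebra by degree -/

namespace FreeSLS

variable (k : Type u) {X : Type v} [CommRing k]

/-- The non-associative monomials of degree `n` in the generators. -/
inductive IsMonomial : ℕ → FreeSLS k X → Prop
  | of (x : X) : IsMonomial 1 (of k x)
  | mul {i j : ℕ} {a b : FreeSLS k X} :
      IsMonomial i a → IsMonomial j b → IsMonomial (i + j) (a * b)

variable {k} in
theorem IsMonomial.pos {n : ℕ} {a : FreeSLS k X} (h : IsMonomial k n a) : 0 < n := by
  induction h with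
  | of x => exact one_pos
  | mul _ _ h _ => omega

/-- The span of the non-associative monomials of degree at most `m`. -/
noncomputable def filt (m : ℕ) : Submodule k (FreeSLS k X) :=
  Submodule.span k {s | ∃ i ≤ m, IsMonomial k i s}

variable {k}

theorem filt_le {m : ℕ} {N : Submodule k (FreeSLS k X)}
    (h : ∀ i ≤ m, ∀ s, IsMonomial k i s → s ∈ N) : filt k m ≤ N := by
  refine Submodule.span_le.2 ?_
  rintro s ⟨i, hi, hs⟩
  exact h i hi s hs

theorem filt_mono {m n : ℕ} (h : m ≤ n) : filt k m ≤ filt (X := X) k n :=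
  filt_le fun i hi _ hs => Submodule.subset_span ⟨i, hi.trans h, hs⟩

theorem of_mem_filt (x : X) : of k x ∈ filt k 1 :=
  Submodule.subset_span ⟨1, le_rfl, .of x⟩

theorem mul_mem_filt {i j : ℕ} {a b : FreeSLS k X} (ha : a ∈ filt k i) (hb : b ∈ filt k j) :
    a * b ∈ filt k (i + j) := by
  have h := Submodule.apply_mem_map₂ (LinearMap.mul k (FreeSLS k X)) ha hb
  rw [filt, filt, Submodule.map₂_span_span] at h
  refine (Submodule.span_le.2 ?_) h
  rintro _ ⟨a, ⟨i', hi, ha⟩, b, ⟨j', hj, hb⟩, rfl⟩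
  exact Submodule.subset_span ⟨i' + j', by omega, ha.mul hb⟩

variable (k) in
-- The elements of finite degree form an SLS-subalgebra containing the generators. The lift into it,
-- followed by the inclusion, is the identity by uniqueness.
theorem exists_mem_filt (s : FreeSLS k X) : ∃ m, s ∈ filt k m := by
  let A : NonUnitalSubalgebra k (FreeSLS k X) :=
    { carrier := {s | ∃ m, s ∈ filt k m}
      add_mem' := by
        rintro a b ⟨i, ha⟩ ⟨j, hb⟩
        exact ⟨i + j, Submodule.add_mem _ (filt_mono (by omega) ha) (filt_mono (by omega) hb)⟩
      zero_mem' := ⟨0, Submodule.zero_mem _⟩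
      mul_mem' := by
        rintro a b ⟨i, ha⟩ ⟨j, hb⟩
        exact ⟨i + j, mul_mem_filt ha hb⟩
      smul_mem' := by
        rintro c a ⟨i, ha⟩
        exact ⟨i, Submodule.smul_mem _ c ha⟩ }
  have hA : IsSLS A :=
    { left_symm := fun a b c => Subtype.ext ((isSLS k X).left_symm a.1 b.1 c.1)
      right_comm := fun a b c e => Subtype.ext ((isSLS k X).right_comm a.1 b.1 c.1 e.1)
      assoc_comm := fun a b c e => Subtype.ext ((isSLS k X).assoc_comm a.1 b.1 c.1 e.1) }
  obtain ⟨F, hF, -⟩ := existsUnique_lift (k := k) hA fun x : X => (⟨of k x, 1, of_mem_filt x⟩ : A)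
  have h := (existsUnique_lift (k := k) (X := X) (isSLS k X) (of k)).unique
    (y₁ := (NonUnitalSubalgebraClass.subtype A).comp F) (y₂ := NonUnitalAlgHom.id k _)
    (fun x => congrArg Subtype.val (hF x)) (fun x => rfl)
  have hs : (F s : FreeSLS k X) = s := DFunLike.congr_fun h s
  exact hs ▸ (F s).2

end FreeSLS

/-! ### The monomials of weight `-1` -/

namespace PermDer

variable {k : Type u} {X : Type v} [CommRing k]

variable (k X) in
/-- The span of the generators and of the monomials `v x^(n)`, `n > 0`, of weight `-1`, restricted
to the degrees up to `m`. -/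
noncomputable def monPart (m : ℕ) : Submodule k (PermDer k X) :=
  Submodule.span k ({f | ∃ x : X, 1 ≤ m ∧ f = gen x} ∪ {f | ∃ (x : X) (n : ℕ) (v : Omega X →₀ ℕ),
    expWt v = -(n + 1 : ℤ) ∧ v.degree + 1 ≤ m ∧ f = PermFree.mon v (x, n + 1)})

theorem gen_mem_monPart (x : X) {m : ℕ} (hm : 1 ≤ m) : (gen x : PermDer k X) ∈ monPart k X m :=
  Submodule.subset_span (Or.inl ⟨x, hm, rfl⟩)

theorem monPart_le {m : ℕ} {N : Submodule k (PermDer k X)} (h₁ : 1 ≤ m → ∀ x, gen x ∈ N)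
    (h₂ : ∀ (x : X) (n : ℕ) (v : Omega X →₀ ℕ), expWt v = -(n + 1 : ℤ) → v.degree + 1 ≤ m →
      PermFree.mon v (x, n + 1) ∈ N) : monPart k X m ≤ N := by
  refine Submodule.span_le.2 ?_
  rintro _ (⟨x, hx, rfl⟩ | ⟨x, n, v, hv, hm, rfl⟩)
  · exact h₁ hx x
  · exact h₂ x n v hv hm

theorem monPart_mono {m n : ℕ} (h : m ≤ n) : monPart k X m ≤ monPart k X n :=
  monPart_le (fun hm x => gen_mem_monPart x (hm.trans h)) fun x n v hv hm =>
    Submodule.subset_span (Or.inr ⟨x, n, v, hv, hm.trans h, rfl⟩)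

variable (k) in
/-- The linear map `p ↦ p y`. -/
noncomputable def termHom (y : Omega X) : MvPolynomial (Omega X) k →ₗ[k] PermDer k X :=
  (Finsupp.lsingle y : MvPolynomial (Omega X) k →ₗ[k] (Omega X →₀ MvPolynomial (Omega X) k))

theorem term_mem_monPart {x : X} {n l m : ℕ} {p : MvPolynomial (Omega X) k}
    (hp : p ∈ wtPart k (-(n + 1 : ℤ)) l) (hm : l + 1 ≤ m) :
    PermFree.term p (x, n + 1) ∈ monPart k X m := by
  suffices h : wtPart k (-(n + 1 : ℤ)) l ≤ (monPart k X m).comap (termHom k (x, n + 1)) from h hp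
  exact wtPart_le fun v hv hl => Submodule.subset_span (Or.inr ⟨x, n, v, hv, by omega, rfl⟩)

theorem d_mon (v : Omega X →₀ ℕ) (x : X) (n : ℕ) :
    d (PermFree.mon v (x, n) : PermDer k X) =
      PermFree.term (dComm (monomial v 1)) (x, n) + PermFree.term (monomial v 1) (x, n + 1) :=
  d_term _ _

/-- This is the Leibniz rule `f (v x^(n+1))' = f v' x^(n+1) + f v x^(n+2)`. It keeps the image of
`ofSLS` inside the span of the listed elements, with control of the degree. -/
theorem smul_d_mem_monPart {i j : ℕ} {f : MvPolynomial (Omega X) k} (hf : f ∈ wtPart k (-1) i)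
    {g : PermDer k X} (hg : g ∈ monPart k X j) : f • d g ∈ monPart k X (i + j) := by
  let φ : PermDer k X →ₗ[k] PermDer k X := (Algebra.lsmul k k (PermDer k X) f).comp d
  suffices h : monPart k X j ≤ (monPart k X (i + j)).comap φ from h hg
  refine monPart_le (fun hj x => ?_) fun x n v hv hm => ?_
  · change f • d (gen x : PermDer k X) ∈ monPart k X (i + j)
    rw [d_gen, PermFree.smul_term, mul_one]
    exact term_mem_monPart (n := 0) (by simpa using hf) (by omega)
  · change f • d (PermFree.mon v (x, n + 1) : PermDer k X) ∈ monPart k X (i + j)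
    have hv' : (monomial v 1 : MvPolynomial (Omega X) k) ∈ wtPart k (-(n + 1 : ℤ)) v.degree :=
      monomial_mem_wtPart hv le_rfl
    rw [d_mon, smul_add, PermFree.smul_term, PermFree.smul_term]
    refine Submodule.add_mem _ (term_mem_monPart (mul_mem_wtPart hf
      (dComm_mem_wtPart hv' (w' := -(n : ℤ)) (by ring)) (by ring) le_rfl) (by omega))
      (term_mem_monPart (mul_mem_wtPart hf hv' (by push_cast; ring) le_rfl) (by omega))

theorem toComm_mem_wtPart {m : ℕ} {g : PermDer k X} (hg : g ∈ monPart k X m) :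
    PermFree.toComm g ∈ wtPart k (-1) m := by
  suffices h : monPart k X m ≤ (wtPart k (-1) m).comap (toCommHom k X) from h hg
  refine monPart_le (fun hm x => ?_) fun x n v hv hm => ?_
  · change PermFree.toComm (gen x : PermDer k X) ∈ wtPart k (-1) m
    rw [toComm_gen]
    exact wtPart_mono hm (X_zero_mem_wtPart x)
  · change PermFree.toComm (PermFree.mon v (x, n + 1) : PermDer k X) ∈ wtPart k (-1) m
    rw [PermFree.mon, PermFree.toComm_term]
    exact mul_mem_wtPart (monomial_mem_wtPart hv le_rfl) (X_succ_mem_wtPart x n) (by ring) hm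

theorem ofSLS_mem_monPart {m : ℕ} {s : FreeSLS k X} (hs : s ∈ FreeSLS.filt k m) :
    ofSLS s ∈ monPart k X m := by
  suffices h : FreeSLS.filt k m ≤ (monPart k X m).comap ofSLS from h hs
  refine FreeSLS.filt_le fun i hi s hs => ?_
  refine monPart_mono hi ?_
  clear hi
  induction hs with
  | of x => rw [ofSLS_of]; exact gen_mem_monPart x le_rfl
  | mul _ _ ha hb => rw [ofSLS_mul]; exact smul_d_mem_monPart (toComm_mem_wtPart ha) hb

/-- If `p` is the commutative image of `s`, then `p x^(1)` is the image of `s * x`. Higher orders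
follow from `y u x^(n+2) = y ∘ (u x^(n+1)) - y u' x^(n+1)`. The assumption `h` is the induction
hypothesis of `exists_toComm_ofSLS_eq`. -/
theorem term_mem_map_ofSLS_of {l : ℕ}
    (h : ∀ i ≤ l, ∀ p ∈ wtPart (X := X) k (-1) i, ∃ s ∈ FreeSLS.filt k i,
      PermFree.toComm (ofSLS s) = p) (x : X) (n : ℕ) : ∀ i ≤ l, ∀ p ∈ wtPart k (-(n + 1 : ℤ)) i,
    PermFree.term p (x, n + 1) ∈ (FreeSLS.filt k (i + 1)).map ofSLS := by
  induction n with
  | zero =>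
    intro i hi p hp
    obtain ⟨s, hs, rfl⟩ := h i hi p (by simpa using hp)
    refine ⟨s * FreeSLS.of k x, FreeSLS.mul_mem_filt hs (FreeSLS.of_mem_filt x), ?_⟩
    rw [ofSLS_mul, ofSLS_of, d_gen, PermFree.smul_term, mul_one]
  | succ n ih =>
    intro i hi p hp
    suffices hle : wtPart k (-((n + 1 : ℕ) + 1 : ℤ)) i ≤
      ((FreeSLS.filt k (i + 1)).map ofSLS).comap (termHom k (x, n + 1 + 1)) from hle hp
    refine wtPart_le fun v hv hvi => ?_
    change (PermFree.term (monomial v 1) (x, n + 1 + 1) : PermDer k X) ∈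
      (FreeSLS.filt k (i + 1)).map ofSLS
    push_cast at hv
    obtain ⟨y, u, rfl⟩ := exists_split_zero (v := v) (by rw [hv]; linarith)
    simp only [map_add, expWt_single, wtLetter, Finsupp.degree_single] at hv hvi
    push_cast at hv
    have hu : (monomial u 1 : MvPolynomial (Omega X) k) ∈ wtPart k (-(n + 1 : ℤ)) u.degree :=
      monomial_mem_wtPart (by linarith) le_rfl
    obtain ⟨b, hb, hbu⟩ := ih u.degree (by omega) _ hu
    have h1 : ofSLS (FreeSLS.of k y * b) ∈ (FreeSLS.filt k (i + 1)).map ofSLS :=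
      ⟨_, FreeSLS.filt_mono (by omega) (FreeSLS.mul_mem_filt (FreeSLS.of_mem_filt y) hb), rfl⟩
    have h2 := ih i hi _ (mul_mem_wtPart (X_zero_mem_wtPart y)
      (dComm_mem_wtPart hu (w' := -(n : ℤ)) (by ring)) (by ring) hvi)
    rw [ofSLS_mul, ofSLS_of, toComm_gen, hbu, d_term, smul_add, PermFree.smul_term,
      PermFree.smul_term, ← monomial_single_add] at h1
    simpa [next] using Submodule.sub_mem _ h1 h2

/-- A monomial of weight `-1` other than a single letter contains some `y^(n+1)`. With that letter
put last, the remaining factor has smaller degree and `term_mem_map_ofSLS_of` applies. -/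
theorem exists_toComm_ofSLS_eq (l : ℕ) : ∀ p ∈ wtPart (X := X) k (-1) l,
    ∃ s ∈ FreeSLS.filt k l, PermFree.toComm (ofSLS s) = p := by
  induction l using Nat.strong_induction_on with
  | _ l ih =>
  intro p hp
  suffices h : wtPart k (-1) l ≤ (FreeSLS.filt k l).map
    ((toCommHom k X).comp ofSLS) from h hp
  refine wtPart_le fun v hv hl => ?_
  obtain ⟨x, u, rfl⟩ := exists_split_zero (v := v) (by rw [hv]; norm_num)
  simp only [map_add, expWt_single, wtLetter, Finsupp.degree_single] at hv hl
  by_cases hu : u = 0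
  · subst hu
    refine ⟨FreeSLS.of k x, FreeSLS.filt_mono (by omega) (FreeSLS.of_mem_filt x), ?_⟩
    change PermFree.toComm (ofSLS _) = _
    rw [ofSLS_of, toComm_gen, add_zero]; rfl
  · obtain ⟨y, n, w, rfl⟩ := exists_split_pos (v := u) (by push_cast at hv; linarith) hu
    simp only [map_add, expWt_single, wtLetter, Finsupp.degree_single] at hv hl
    push_cast at hv
    obtain ⟨s, hs, hsv⟩ := term_mem_map_ofSLS_of (l := w.degree + 1)
      (fun i hi => ih i (by omega)) y n (w.degree + 1) le_rfl
      (monomial (Finsupp.single (x, 0) 1 + w) 1)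
      (monomial_mem_wtPart (by rw [map_add, expWt_single, wtLetter]; push_cast; linarith)
        (by rw [map_add, Finsupp.degree_single, add_comm]))
    refine ⟨s, FreeSLS.filt_mono (by omega) hs, ?_⟩
    change PermFree.toComm (ofSLS s) = _
    rw [hsv, PermFree.toComm_term, mul_comm, ← monomial_single_add, add_left_comm]

theorem exists_ofSLS_eq_term (x : X) (n : ℕ) {i : ℕ} {p : MvPolynomial (Omega X) k}
    (hp : p ∈ wtPart k (-(n + 1 : ℤ)) i) :
    ∃ s ∈ FreeSLS.filt k (i + 1), ofSLS s = PermFree.term p (x, n + 1) :=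
  term_mem_map_ofSLS_of (fun i _ => exists_toComm_ofSLS_eq i) x n i le_rfl p hp

end PermDer

variable {k : Type u} {X : Type v} [CommRing k]

/-! ### Operators of left multiplication -/

namespace FreeSLS

variable (k X) in
/-- Left multiplication in the free SLS-algebra. -/
noncomputable def mulL : FreeSLS k X →ₗ[k] Module.End k (FreeSLS k X) :=
  LinearMap.mul k (FreeSLS k X)

theorem mulL_mul_right_comm (a b c : FreeSLS k X) :
    mulL k X (a * b * c) = mulL k X (a * c * b) :=
  LinearMap.ext fun e => (isSLS k X).right_comm a b c e

/-- The left annihilator is stable under left multiplication. -/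
theorem mulL_mul_congr (s : FreeSLS k X) {a b : FreeSLS k X} (h : mulL k X a = mulL k X b) :
    mulL k X (s * a) = mulL k X (s * b) := by
  have hz : ∀ t, (a - b) * t = 0 := fun t => by
    rw [sub_mul, sub_eq_zero]; exact LinearMap.congr_fun h t
  rw [← sub_eq_zero, ← map_sub, ← mul_sub]
  refine LinearMap.ext fun t => ?_
  change s * (a - b) * t = 0
  -- With `c = a - b`, which annihilates everything on its right, left symmetry `(s c) t - s (c t) =
  -- (c s) t - c (s t)` reduces to `(s c) t = 0`.
  have := (isSLS k X).left_symm s (a - b) t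
  simpa [associator_apply, hz, sub_eq_zero] using this

end FreeSLS

/-! ### Left multiplications represented on commutative polynomials, and the inverse map -/

namespace PermDer

open FreeSLS (filt mulL of)

/-- The operator `l` represents the left multiplication by elements of degree at most `m`. -/
def IsRep (l : MvPolynomial (Omega X) k →ₗ[k] Module.End k (FreeSLS k X)) (m : ℕ) : Prop :=
  ∀ s ∈ filt k m, l (PermFree.toComm (ofSLS s)) = mulL k X s

variable {l : MvPolynomial (Omega X) k →ₗ[k] Module.End k (FreeSLS k X)} {m : ℕ}

theorem IsRep.braceStep (hl : IsRep l m) {i j : ℕ} (h : i + j ≤ m) {a b : FreeSLS k X}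
    (ha : a ∈ filt k i) (hb : b ∈ filt k j) (e : FreeSLS k X) :
    braceStep l l (PermFree.toComm (ofSLS a)) (PermFree.toComm (ofSLS b)) e
      = -associator a b e := by
  rw [braceStep_apply, ← toComm_ofSLS_mul, hl a (FreeSLS.filt_mono (by omega) ha),
    hl b (FreeSLS.filt_mono (by omega) hb), hl _ (FreeSLS.filt_mono h (FreeSLS.mul_mem_filt ha hb)),
    associator_apply, neg_sub]
  rfl

/-- Elements of weight `-1` lift to the free SLS-algebra without increase of degree, and `braceStep
l l` then becomes minus an associator. So the two conditions are the two associator identities. -/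
theorem IsRep.isBraceable (hl : IsRep l m) : IsBraceable l m where
  symm i j h f hf g hg := by
    obtain ⟨a, ha, rfl⟩ := exists_toComm_ofSLS_eq i f hf
    obtain ⟨b, hb, rfl⟩ := exists_toComm_ofSLS_eq j g hg
    refine LinearMap.ext fun e => ?_
    rw [hl.braceStep h ha hb, hl.braceStep (by omega) hb ha, (FreeSLS.isSLS k X).left_symm]
  exch i j e h f hf g hg c hc := by
    obtain ⟨a, ha, rfl⟩ := exists_toComm_ofSLS_eq i f hf
    obtain ⟨b, hb, rfl⟩ := exists_toComm_ofSLS_eq j g hg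
    obtain ⟨c, hc', rfl⟩ := exists_toComm_ofSLS_eq e c hc
    refine LinearMap.ext fun t => ?_
    rw [← toComm_ofSLS_mul, ← toComm_ofSLS_mul,
      hl.braceStep (j := j + e) (by omega) ha (FreeSLS.mul_mem_filt hb hc'),
      hl.braceStep (j := i + e) (by omega) hb (FreeSLS.mul_mem_filt ha hc'),
      (FreeSLS.isSLS k X).assoc_comm]

theorem IsRep.apply_X (hl : IsRep l m) (hm : 1 ≤ m) (x : X) :
    l (MvPolynomial.X (x, 0)) = mulL k X (of k x) := by
  rw [← hl _ (FreeSLS.filt_mono hm (FreeSLS.of_mem_filt x)), ofSLS_of, toComm_gen]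

/-- The linear map from `PermDer⟨X, d⟩` to `SLS⟨X⟩` with `x ↦ x` and
`v x^(n + 1) ↦ brace l n v x`. -/
noncomputable def toSLS (l : MvPolynomial (Omega X) k →ₗ[k] Module.End k (FreeSLS k X)) :
    PermDer k X →ₗ[k] FreeSLS k X :=
  (Finsupp.lsum k fun y : Omega X => Nat.casesOn y.2
    -- With a last letter of order zero only the generators matter, so just the constant coefficient
    -- is read off.
    ((MvPolynomial.lcoeff k 0).smulRight (of k y.1))
    fun n => (LinearMap.applyₗ (of k y.1)).comp (brace l n) :
    (Omega X →₀ MvPolynomial (Omega X) k) →ₗ[k] FreeSLS k X)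

theorem toSLS_gen (x : X) : toSLS l (gen x) = of k x := by
  classical
  refine (Finsupp.lsum_single k _ _ _).trans ?_
  change MvPolynomial.coeff 0 (monomial 0 (1 : k)) • of k x = of k x
  rw [MvPolynomial.coeff_monomial, if_pos rfl, one_smul]

theorem toSLS_term (p : MvPolynomial (Omega X) k) (x : X) (n : ℕ) :
    toSLS l (PermFree.term p (x, n + 1)) = brace l n p (of k x) :=
  Finsupp.lsum_single k _ _ _

/-- The brace recursion was designed for this. The total degree may reach `m + 1` because the last
letter of `g` is not part of the argument of the brace. -/
theorem IsRep.toSLS_smul_d (hl : IsRep l m) {i j : ℕ} (h : i + j ≤ m + 1)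
    {f : MvPolynomial (Omega X) k} (hf : f ∈ wtPart k (-1) i) {g : PermDer k X}
    (hg : g ∈ monPart k X j) : toSLS l (f • d g) = l f (toSLS l g) := by
  suffices hle : monPart k X j ≤ LinearMap.eqLocus
    ((toSLS l).comp ((Algebra.lsmul k k (PermDer k X) f).comp d)) ((l f).comp (toSLS l)) from hle hg
  refine monPart_le (fun hj x => ?_) fun x n v hv hj => ?_
  · change toSLS l (f • d (gen x)) = l f (toSLS l (gen x))
    rw [d_gen, PermFree.smul_term, mul_one, toSLS_gen]
    exact toSLS_term f x 0
  · change toSLS l (f • d (PermFree.mon v (x, n + 1))) = l f (toSLS l (PermFree.mon v (x, n + 1)))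
    rw [d_mon, smul_add, PermFree.smul_term, PermFree.smul_term, map_add, toSLS_term,
      toSLS_term, hl.isBraceable.brace_succ n (j := v.degree) (by omega) hf
        (monomial_mem_wtPart hv le_rfl), PermFree.mon, toSLS_term]
    exact add_sub_cancel _ _

theorem IsRep.toSLS_ofSLS (hl : IsRep l m) {s : FreeSLS k X} (hs : s ∈ filt k (m + 1)) :
    toSLS l (ofSLS s) = s := by
  suffices h : filt k (m + 1) ≤ LinearMap.eqLocus ((toSLS l).comp ofSLS) LinearMap.id from h hs
  refine FreeSLS.filt_le fun i hi s hs => ?_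
  change toSLS l (ofSLS s) = s
  induction hs with
  | of x => rw [ofSLS_of, toSLS_gen]
  | @mul i j a b ha hb iha ihb =>
    -- Both factors have positive degree, so `a` has degree at most `m` and its left multiplication
    -- is still represented by `l`.
    have hi' := ha.pos
    have hj' := hb.pos
    have ha' : a ∈ filt k i := Submodule.subset_span ⟨i, le_rfl, ha⟩
    have hb' : b ∈ filt k j := Submodule.subset_span ⟨j, le_rfl, hb⟩
    rw [ofSLS_mul, hl.toSLS_smul_d hi (toComm_mem_wtPart (ofSLS_mem_monPart ha'))
      (ofSLS_mem_monPart hb'), ihb (by omega), hl a (FreeSLS.filt_mono (by omega) ha')]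
    rfl

/-! ### Exchanging the last letter modulo the left annihilator -/

/-- The linear map `p ↦ T(p q) y`, with values in the operators of left multiplication. -/
noncomputable def mulLApply (T : MvPolynomial (Omega X) k →ₗ[k] Module.End k (FreeSLS k X))
    (q : MvPolynomial (Omega X) k) (y : X) :
    MvPolynomial (Omega X) k →ₗ[k] Module.End k (FreeSLS k X) :=
  (mulL k X).comp ((T.comp (LinearMap.mulRight k q)).flip (of k y))

theorem mulLApply_apply (T : MvPolynomial (Omega X) k →ₗ[k] Module.End k (FreeSLS k X))
    (p q : MvPolynomial (Omega X) k) (y : X) :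
    mulLApply T q y p = mulL k X (T (p * q) (of k y)) := rfl

theorem mulLApply_eq_of_X_mul {T U : MvPolynomial (Omega X) k →ₗ[k] Module.End k (FreeSLS k X)}
    {q r : MvPolynomial (Omega X) k} {y z : X} {w : ℤ} {e : ℕ} (hw : w ≤ 0)
    (h : ∀ (x : X) (i : ℕ), i + 1 ≤ e → ∀ p ∈ wtPart k w i,
      mulL k X (T (MvPolynomial.X (x, 0) * p * q) (of k y))
        = mulL k X (U (MvPolynomial.X (x, 0) * p * r) (of k z)))
    {v : MvPolynomial (Omega X) k} (hv : v ∈ wtPart k (w - 1) e) :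
    mulL k X (T (v * q) (of k y)) = mulL k X (U (v * r) (of k z)) := by
  suffices hle : wtPart k (w - 1) e ≤ LinearMap.eqLocus (mulLApply T q y) (mulLApply U r z) from
    hle hv
  refine wtPart_le fun v hv hve => ?_
  obtain ⟨x, u, rfl⟩ := exists_split_zero (v := v) (by rw [hv]; linarith)
  simp only [map_add, expWt_single, wtLetter, Finsupp.degree_single] at hv hve
  push_cast at hv
  rw [LinearMap.mem_eqLocus, mulLApply_apply, mulLApply_apply, monomial_single_add]
  exact h x u.degree (by omega) _ (monomial_mem_wtPart (by linarith) le_rfl)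

/-- Apply `l` to the commutative image of `x ∘ (w y^(j+1)) = x w' y^(j+1) + x w y^(j+2)`. The
preimage of `w y^(j+1)` is `brace l j w y`, by `IsRep.toSLS_ofSLS`. -/
theorem IsRep.apply_mul_letter (hl : IsRep l m) (y x : X) {j i : ℕ} (hi : i + 2 ≤ m)
    {w : MvPolynomial (Omega X) k} (hw : w ∈ wtPart k (-(j + 1 : ℤ)) i) :
    l (MvPolynomial.X (x, 0) * w * MvPolynomial.X (y, j + 1 + 1))
      = mulL k X (of k x * brace l j w (of k y))
        - l (MvPolynomial.X (x, 0) * dComm w * MvPolynomial.X (y, j + 1)) := by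
  obtain ⟨b, hb, hbw⟩ := exists_ofSLS_eq_term y j hw
  have hb' : brace l j w (of k y) = b := by
    rw [← toSLS_term, ← hbw]
    exact hl.toSLS_ofSLS (FreeSLS.filt_mono (by omega) hb)
  have h := hl (of k x * b) (FreeSLS.filt_mono (by omega)
    (FreeSLS.mul_mem_filt (FreeSLS.of_mem_filt x) hb))
  have hp : PermFree.toComm (ofSLS (of k x * b))
      = MvPolynomial.X (x, 0) * w * MvPolynomial.X (y, j + 1 + 1)
        + MvPolynomial.X (x, 0) * dComm w * MvPolynomial.X (y, j + 1) := by
    rw [toComm_ofSLS_mul, ofSLS_of, toComm_gen, hbw, PermFree.toComm_term, dComm_mul, dComm_X,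
      show next (y, j + 1) = (y, j + 1 + 1) from rfl, mul_add, add_comm, mul_assoc, mul_assoc]
  rw [hp, map_add] at h
  rw [hb', ← h, add_sub_cancel_right]

/-- The factor of weight `-1` split off is `x z^(1)`, the commutative image of the product of the
generators `x` and `z`, rather than a single letter. -/
theorem IsRep.brace_mul_letter_one (hl : IsRep l m) (x z : X) {j i : ℕ} (hi : i + 2 ≤ m)
    {w : MvPolynomial (Omega X) k} (hw : w ∈ wtPart k (-(j + 1 : ℤ)) i) :
    brace l (j + 1) (MvPolynomial.X (x, 0) * w * MvPolynomial.X (z, 1))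
      = mulL k X (of k x * of k z) * brace l j w
        - brace l j (MvPolynomial.X (x, 0) * dComm w * MvPolynomial.X (z, 1)) := by
  have hxz : PermFree.toComm (ofSLS (of k x * of k z))
      = (MvPolynomial.X (x, 0) * MvPolynomial.X (z, 1) : MvPolynomial (Omega X) k) := by
    rw [toComm_ofSLS_mul, ofSLS_of, ofSLS_of, toComm_gen, toComm_gen, dComm_X]; rfl
  have hxz' : of k x * of k z ∈ filt k (1 + 1) :=
    FreeSLS.mul_mem_filt (FreeSLS.of_mem_filt x) (FreeSLS.of_mem_filt z)
  have hmem := toComm_mem_wtPart (ofSLS_mem_monPart hxz')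
  have h := hl.isBraceable.brace_succ j (by omega) hmem hw
  rw [hl _ (FreeSLS.filt_mono (by omega) hxz'), hxz] at h
  rw [mul_right_comm, mul_right_comm _ (dComm w), h]

theorem IsRep.brace_mul_letter (hl : IsRep l m) (x y z : X) {n j i : ℕ} (hi : i + 2 ≤ m)
    {w : MvPolynomial (Omega X) k} (hw : w ∈ wtPart k (-(n + j + 1 : ℤ)) i) :
    brace l (n + 1) (MvPolynomial.X (x, 0) * w * MvPolynomial.X (y, j + 1)) (of k z)
      = of k x * brace l n (w * MvPolynomial.X (y, j + 1)) (of k z)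
        - brace l n (MvPolynomial.X (x, 0) * dComm w * MvPolynomial.X (y, j + 1)) (of k z)
        - brace l n (MvPolynomial.X (x, 0) * w * MvPolynomial.X (y, j + 1 + 1)) (of k z) := by
  have h := hl.isBraceable.brace_succ n (by omega) (X_zero_mem_wtPart x)
    (mul_mem_wtPart hw (X_succ_mem_wtPart y j) (c := -(n + 1 : ℤ)) (by ring) le_rfl)
  rw [hl.apply_X (by omega), dComm_mul, dComm_X, mul_add, map_add, ← sub_sub,
    ← mul_assoc, ← mul_assoc, ← mul_assoc] at h
  rw [h]
  rfl

/-- For `j = 0` this is right commutativity, `(a y) z` against `(a z) y`, where `a` lifts `v`. In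
the induction step the leading terms are `(x b) z` and `(x z) b` with `b = brace l j w y`, again
related by right commutativity; the other terms match by induction. -/
theorem IsRep.brace_swap_zero (hl : IsRep l m) (y z : X) (j : ℕ) : ∀ e, e + 1 ≤ m →
    ∀ v ∈ wtPart k (-(j + 1 : ℤ)) e,
      mulL k X (l (v * MvPolynomial.X (y, j + 1)) (of k z))
        = mulL k X (brace l j (v * MvPolynomial.X (z, 1)) (of k y)) := by
  induction j with
  | zero =>
    intro e he v hv
    obtain ⟨a, ha, rfl⟩ := exists_toComm_ofSLS_eq e v (by simpa using hv)
    have key : ∀ y : X, l (PermFree.toComm (ofSLS a) * MvPolynomial.X (y, 1))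
        = mulL k X (a * of k y) := fun y => by
      rw [← hl _ (FreeSLS.filt_mono he (FreeSLS.mul_mem_filt ha (FreeSLS.of_mem_filt y))),
        toComm_ofSLS_mul, ofSLS_of, toComm_gen, dComm_X]
      rfl
    rw [brace_zero, key z]
    exact (congrArg (fun f => mulL k X (f (of k z))) (key y)).trans
      (FreeSLS.mulL_mul_right_comm _ _ _)
  | succ j ih =>
    intro e he v hv
    have hv' : v ∈ wtPart k (-(j + 1 : ℤ) - 1) e := by convert hv using 2; push_cast; ring
    refine mulLApply_eq_of_X_mul (by linarith) (fun x i hi w hw => ?_) hv'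
    have e2 := ih (1 + i) (by omega) _ (mul_mem_wtPart (X_zero_mem_wtPart x)
      (dComm_mem_wtPart hw (w' := -(j : ℤ)) (by ring)) (by ring) le_rfl)
    rw [hl.apply_mul_letter y x (by omega) hw, hl.brace_mul_letter_one x z (by omega) hw,
      LinearMap.sub_apply, LinearMap.sub_apply, map_sub, map_sub, e2, Module.End.mul_apply]
    exact congrArg (· - _) (FreeSLS.mulL_mul_right_comm (of k x) _ (of k z))

/-- Modulo the left annihilator, the images of `v y^(j + 1) z^(n + 1)` and `v z^(n + 1) y^(j + 1)`
are the same. -/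
theorem IsRep.brace_swap (hl : IsRep l m) (y z : X) (n : ℕ) : ∀ j e : ℕ, e + 1 ≤ m →
    ∀ v ∈ wtPart k (-(n + j + 1 : ℤ)) e,
      mulL k X (brace l n (v * MvPolynomial.X (y, j + 1)) (of k z))
        = mulL k X (brace l j (v * MvPolynomial.X (z, n + 1)) (of k y)) := by
  induction n with
  | zero =>
    intro j e he v hv
    exact hl.brace_swap_zero y z j e he v (by simpa using hv)
  | succ n ih =>
    intro j e he v hv
    have hv' : v ∈ wtPart k (-(n + j + 1 : ℤ) - 1) e := by convert hv using 2; push_cast; ring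
    refine mulLApply_eq_of_X_mul (by linarith) (fun x i hi w hw => ?_) hv'
    -- `e1` and `e2` expand the braces of `x w y^(j+1)` and `x w z^(n+1)`. By induction the first
    -- two terms on the right agree (`e3`, where the left annihilator must be stable under
    -- multiplication by `x`, and `e4`). `e5` turns the third term of `e1` into the left side of
    -- `e2`, and everything cancels except the third term of `e2`, the one wanted.
    have e1 := congrArg (mulL k X) (hl.brace_mul_letter x y z (n := n) (j := j) (by omega) hw)
    have e2 := congrArg (mulL k X) (hl.brace_mul_letter x z y (n := j) (j := n) (w := w)
      (i := i) (by omega) (by rwa [add_comm (j : ℤ)]))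
    have e3 := FreeSLS.mulL_mul_congr (of k x) (ih j i (by omega) w hw)
    have e4 := ih j (1 + i) (by omega) _ (mul_mem_wtPart (X_zero_mem_wtPart x)
      (dComm_mem_wtPart hw (w' := -(n + j : ℤ)) (by ring)) (by ring) le_rfl)
    have e5 := ih (j + 1) (1 + i) (by omega) _ (mul_mem_wtPart (X_zero_mem_wtPart x) hw
      (by push_cast; ring) le_rfl)
    rw [map_sub, map_sub] at e1 e2
    rw [e1, e3, e4, e5, e2]
    abel

/-- `f` is a generator, or a monomial `v x^(n)`, `n > 0`, of weight `-1` and of degree at most `m`,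
and its commutative image is the monomial with the exponents `a`. -/
def IsLift (m : ℕ) (a : Omega X →₀ ℕ) (f : PermDer k X) : Prop :=
  (∃ x : X, a = Finsupp.single (x, 0) 1 ∧ f = gen x) ∨
    ∃ (x : X) (n : ℕ) (v : Omega X →₀ ℕ), expWt v = -(n + 1 : ℤ) ∧ v.degree + 1 ≤ m ∧
      a = Finsupp.single (x, n + 1) 1 + v ∧ f = PermFree.mon v (x, n + 1)

theorem single_zero_ne (x y : X) (n : ℕ) (v : Omega X →₀ ℕ) :
    Finsupp.single (x, 0) 1 ≠ Finsupp.single (y, n + 1) 1 + v := by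
  intro h
  have := DFunLike.congr_fun h (y, n + 1)
  simp at this
  omega

/-- Two lifts of one commutative monomial differ only in which letter of positive order stands last,
and `IsRep.brace_swap` exchanges two such letters. A generator has no other lift. -/
theorem IsRep.mulL_toSLS_eq (hl : IsRep l m) {a : Omega X →₀ ℕ} {f g : PermDer k X}
    (hf : IsLift (m + 1) a f) (hg : IsLift (m + 1) a g) :
    mulL k X (toSLS l f) = mulL k X (toSLS l g) := by
  rcases hf with ⟨x, rfl, rfl⟩ | ⟨x, n, v, hv, hm, rfl, rfl⟩ <;>
    rcases hg with ⟨y, hy, rfl⟩ | ⟨y, j, u, hu, hm', hy, rfl⟩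
  · obtain rfl : x = y := congrArg Prod.fst (Finsupp.single_left_injective one_ne_zero hy)
    rfl
  · exact absurd hy (single_zero_ne _ _ _ _)
  · exact absurd hy.symm (single_zero_ne _ _ _ _)
  · by_cases hxy : (x, n + 1) = (y, j + 1)
    · rw [hxy] at hy ⊢
      rw [add_left_cancel hy]
    · obtain ⟨w, rfl⟩ : ∃ w, v = Finsupp.single (y, j + 1) 1 + w := by
        refine exists_eq_single_add fun h0 => ?_
        have := DFunLike.congr_fun hy (y, j + 1)
        simp [h0, Finsupp.single_eq_of_ne (Ne.symm hxy)] at this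
        omega
      rw [add_left_comm] at hy
      rw [← add_left_cancel hy]
      simp only [map_add, expWt_single, wtLetter, Finsupp.degree_single] at hv hm
      push_cast at hv
      rw [PermFree.mon, PermFree.mon, toSLS_term, toSLS_term, monomial_single_add,
        monomial_single_add, mul_comm, mul_comm (MvPolynomial.X (x, n + 1))]
      exact hl.brace_swap y x n j w.degree (by omega) _
        (monomial_mem_wtPart (by linarith) le_rfl)

/-- The new operator sends a commutative monomial to left multiplication by `toSLS l` of any of its
lifts. It represents left multiplications one degree further because `toSLS l` inverts `ofSLS` up to
degree `m + 1`. -/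
theorem IsRep.exists_succ (hl : IsRep l m) :
    ∃ l' : MvPolynomial (Omega X) k →ₗ[k] Module.End k (FreeSLS k X), IsRep l' (m + 1) := by
  classical
  let l' : MvPolynomial (Omega X) k →ₗ[k] Module.End k (FreeSLS k X) :=
    (MvPolynomial.basisMonomials (Omega X) k).constr k fun a =>
      if h : ∃ f : PermDer k X, IsLift (m + 1) a f then mulL k X (toSLS l h.choose) else 0
  have key : ∀ a f, IsLift (m + 1) a f → l' (monomial a 1) = mulL k X (toSLS l f) := by
    intro a f hf
    have h : ∃ f : PermDer k X, IsLift (m + 1) a f := ⟨f, hf⟩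
    have hb : (monomial a 1 : MvPolynomial (Omega X) k) = MvPolynomial.basisMonomials _ k a :=
      (congrFun (MvPolynomial.coe_basisMonomials _ _) a).symm
    rw [hb, Module.Basis.constr_basis, dif_pos h]
    exact hl.mulL_toSLS_eq h.choose_spec hf
  refine ⟨l', fun s hs => ?_⟩
  have hle : monPart k X (m + 1) ≤ LinearMap.eqLocus (l'.comp (toCommHom k X))
      ((mulL k X).comp (toSLS l)) := by
    refine monPart_le (fun _ x => ?_) fun x n v hv hm => ?_
    · change l' (PermFree.toComm (gen x)) = mulL k X (toSLS l (gen x))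
      rw [toComm_gen]
      exact key _ _ (Or.inl ⟨x, rfl, rfl⟩)
    · change l' (PermFree.toComm (PermFree.mon v (x, n + 1)))
        = mulL k X (toSLS l (PermFree.mon v (x, n + 1)))
      rw [PermFree.mon, PermFree.toComm_term, mul_comm, ← monomial_single_add]
      exact key _ _ (Or.inr ⟨x, n, v, hv, hm, rfl, rfl⟩)
  have := hle (ofSLS_mem_monPart hs)
  change l' (PermFree.toComm (ofSLS s)) = mulL k X (toSLS l (ofSLS s)) at this
  rw [this, hl.toSLS_ofSLS hs]

variable (k X) in
theorem exists_isRep (m : ℕ) :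
    ∃ l : MvPolynomial (Omega X) k →ₗ[k] Module.End k (FreeSLS k X), IsRep l m := by
  induction m with
  | zero =>
    refine ⟨0, fun s hs => ?_⟩
    have h : filt k 0 ≤ (⊥ : Submodule k (FreeSLS k X)) :=
      FreeSLS.filt_le fun i hi s hs => absurd hs.pos (by omega)
    rw [(Submodule.mem_bot k).1 (h hs), map_zero, map_zero, map_zero, map_zero]
  | succ m ih =>
    obtain ⟨l, hl⟩ := ih
    exact hl.exists_succ

theorem ofSLS_injective : Function.Injective (ofSLS (k := k) (X := X)) := by
  refine (injective_iff_map_eq_zero _).2 fun s hs => ?_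
  obtain ⟨m, hm⟩ := FreeSLS.exists_mem_filt k s
  obtain ⟨l, hl⟩ := exists_isRep k X m
  rw [← hl.toSLS_ofSLS (FreeSLS.filt_mono m.le_succ hm), hs, map_zero]

/-! ### The subalgebra `F` -/

theorem gen_mem_subalgF (x : X) : gen x ∈ subalgF k X :=
  Submodule.mem_sInf.2 fun _ hS => hS.1 x

theorem circ_mem_subalgF {f g : PermDer k X} (hf : f ∈ subalgF k X) (hg : g ∈ subalgF k X) :
    circ f g ∈ subalgF k X :=
  Submodule.mem_sInf.2 fun S hS => hS.2 f (Submodule.mem_sInf.1 hf S hS) g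
    (Submodule.mem_sInf.1 hg S hS)

theorem range_ofSLS : LinearMap.range (ofSLS (k := k) (X := X)) = subalgF k X := by
  apply le_antisymm
  · rintro _ ⟨s, rfl⟩
    obtain ⟨m, hm⟩ := FreeSLS.exists_mem_filt k s
    suffices h : filt k m ≤ (subalgF k X).comap ofSLS from h hm
    refine FreeSLS.filt_le fun i hi s hs => ?_
    clear hi
    change ofSLS s ∈ subalgF k X
    induction hs with
    | of x => rw [ofSLS_of]; exact gen_mem_subalgF x
    | mul _ _ ha hb => rw [ofSLS_mul]; exact circ_mem_subalgF ha hb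
  · refine sInf_le ⟨fun x => ⟨of k x, ofSLS_of x⟩, ?_⟩
    rintro _ ⟨a, rfl⟩ _ ⟨b, rfl⟩
    exact ⟨a * b, ofSLS_mul a b⟩

theorem span_basisMonomials_union :
    Submodule.span k (basisMonomials k X ∪ Set.range gen) = subalgF k X := by
  rw [← range_ofSLS]
  apply le_antisymm
  · refine Submodule.span_le.2 ?_
    rintro _ (⟨v, x, n, hn, hw, rfl⟩ | ⟨x, rfl⟩)
    · obtain ⟨n, rfl⟩ := Nat.exists_eq_add_one.2 hn
      obtain ⟨s, -, hs⟩ := exists_ofSLS_eq_term (k := k) x n (p := monomial v 1)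
        (monomial_mem_wtPart (by
          rw [wt_eq, wtLetter] at hw; push_cast at hw; linarith) le_rfl)
      exact ⟨s, hs⟩
    · exact ⟨of k x, ofSLS_of x⟩
  · rintro _ ⟨s, rfl⟩
    obtain ⟨m, hm⟩ := FreeSLS.exists_mem_filt k s
    refine monPart_le (fun _ x => Submodule.subset_span (Or.inr ⟨x, rfl⟩)) (fun x n v hv _ => ?_)
      (ofSLS_mem_monPart hm)
    refine Submodule.subset_span (Or.inl ⟨v, x, n + 1, n.succ_pos, ?_, rfl⟩)
    rw [wt_eq, wtLetter, hv]; push_cast; ring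

end PermDer

/-! ### Linear independence of the monomials -/

namespace PermFree

variable (k) in
theorem linearIndependent_mon (Y : Type v) :
    LinearIndependent k fun p : (_ : Y) × (Y →₀ ℕ) => (mon p.2 p.1 : PermFree k Y) := by
  have h := (Finsupp.basis fun _ : Y => MvPolynomial.basisMonomials Y k).linearIndependent
  have e : ⇑(Finsupp.basis fun _ : Y => MvPolynomial.basisMonomials Y k)
      = fun p => Finsupp.single p.1 (monomial p.2 (1 : k)) := by
    funext p
    rw [Finsupp.coe_basis]
    exact congrArg _ (congrFun (MvPolynomial.coe_basisMonomials _ _) p.2)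
  rw [e] at h
  exact h

end PermFree

end SLSPaper

theorem mainTheorem5 {k : Type*} [Field k] {X : Type*} [Nonempty X] :
    (LinearIndependent k
        (Subtype.val : ↥(SLSPaper.PermDer.basisMonomials k X ∪ Set.range SLSPaper.PermDer.gen) →
          SLSPaper.PermDer k X) ∧
      Submodule.span k (SLSPaper.PermDer.basisMonomials k X ∪ Set.range SLSPaper.PermDer.gen) =
        SLSPaper.PermDer.subalgF k X) ∧
    ∃ τ : SLSPaper.FreeSLS k X ≃ₗ[k] SLSPaper.PermDer.subalgF k X,
      (∀ x : X, (τ (SLSPaper.FreeSLS.of k x) : SLSPaper.PermDer k X) = SLSPaper.PermDer.gen x) ∧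
      ∀ f g : SLSPaper.FreeSLS k X,
        (τ (f * g) : SLSPaper.PermDer k X) = SLSPaper.PermDer.circ (τ f) (τ g) := by
  refine ⟨⟨?_, SLSPaper.PermDer.span_basisMonomials_union⟩, ?_⟩
  · refine (SLSPaper.PermFree.linearIndependent_mon k (SLSPaper.Omega X)).linearIndepOn_id.mono ?_
    rintro _ (⟨v, x, n, -, -, rfl⟩ | ⟨x, rfl⟩)
    · exact ⟨⟨(x, n), v⟩, rfl⟩
    · exact ⟨⟨(x, 0), 0⟩, rfl⟩
  · exact ⟨(LinearEquiv.ofInjective _ SLSPaper.PermDer.ofSLS_injective).trans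
      (LinearEquiv.ofEq _ _ SLSPaper.PermDer.range_ofSLS), SLSPaper.PermDer.ofSLS_of,
      SLSPaper.PermDer.ofSLS_mul⟩
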